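/- Let $\Omega=\{0,1\}^{\mathbb Z}$. For $\eta\in\Omega$ let $\eta^{x,x+1}$ denote $\eta$ with the values at $x$ and $x+1$ exchanged. Let $(c_x(\eta))_{x\in\mathbb Z,\eta\in\Omega}$ be nonnegative real numbers such that: $c_x(\eta)=c_0(\eta(x+\cdot))$ for all $x,\eta$; $c_0$ is local (it depends on finitely many coordinates); $c_0(\eta)=c_0(\eta^{0,1})$ for all $\eta$; and, for all $\eta$, $c_0(\eta)>0$ if and only if $\eta(-1)+\eta(2)>0$. For local $f:\Omega\to\mathbb R$ put $$\mathcal L f(\eta)=\sum_{x\in\mathbb Z}c_x(\eta)\,[f(\eta^{x,x+1})-f(\eta)].$$ A probability measure $\nu$ on $\Omega$ is called stationary if $\int \mathcal L f\,d\nu=0$ for all local $f$. Define $$\mathcal F=\{\eta:\ \forall x,\ \eta(x)=1\Rightarrow\eta(x+1)+\eta(x+2)=0\},$$ $$\mathcal F'=\bigcup_{k\ge2}\{\eta\notin\mathcal F:\ \textstyle\sum_x\eta(x)=k\},\qquad \mathcal F''=\bigcup_{k\ge0}\{\eta\notin\mathcal F:\ \textstyle\sum_x(1-\eta(x))=k\},$$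 $$\mathcal E'=\{\eta\notin\mathcal F':\ 0<\textstyle\sum_x(\eta(x)\eta(x+1)+\eta(x)\eta(x+2))<\infty\},\qquad \mathcal E=\Omega\setminus(\mathcal F\cup\mathcal F'\cup\mathcal F''\cup\mathcal E').$$ Let $\mathbf 1\in\mathcal F''$ be the configuration with a particle at every site, $\delta_{\mathbf 1}$ the Dirac mass at it, and, for $\rho\in[0,1]$, let $\mu_\rho=\bigotimes_{x\in\mathbb Z}\mathrm{Ber}(\rho)$. **Theorem.** Let $\nu$ be a stationary probability measure. Then there are stationary probability measures $\nu_{\mathcal F}$, $\nu_{\mathcal E}$ with $\nu_{\mathcal F}(\mathcal F)=1$, $\nu_{\mathcal E}(\mathcal E)=1$ and $$\nu=\nu(\mathcal F)\,\nu_{\mathcal F}+\nu(\{\mathbf 1\})\,\delta_{\mathbf 1}+\nu(\mathcal E)\,\nu_{\mathcal E},$$ and, if $\nu(\mathcal E)>0$, there is a probability measure $\lambda$ on $(0,1)$ such that $\nu_{\mathcal E}=\int_0^1\mu_\rho\,d\lambda(\rho)$. Moreover $\nu(\mathcal F')=\nu(\mathcal F''\setminus\{\mathbf 1\})=\nu(\mathcal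 E')=0$. In particular, if $\nu(\{\mathbf 1\})=0$, then $\nu=\nu(\mathcal F)\nu_{\mathcal F}+\nu(\mathcal E)\nu_{\mathcal E}$ and $\mathcal F',\mathcal F'',\mathcal E'$ are $\nu$-null. -/

import Mathlib

open MeasureTheory ProbabilityTheory
open scoped ENNReal

namespace PorousMedium

/-- The configurations `η ∈ {0,1}^ℤ`; `η x = true` means that there is a particle at `x`. -/
abbrev Config : Type := ℤ → Bool

/-- The occupation number `η(x) ∈ {0,1}`. -/
def occ (η : Config) (x : ℤ) : ℕ := (η x).toNat

/-- `η^{x,x+1}`: the configuration `η` with the contents of `x` and `x+1` exchanged. -/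
def exch (x : ℤ) (η : Config) : Config := fun y => η (Equiv.swap x (x + 1) y)

/-- A function of the configuration is local if it depends on finitely many coordinates. -/
def IsLocal (f : Config → ℝ) : Prop := ∃ Λ : Finset ℤ, DependsOn f (Λ : Set ℤ)

/-- The assumptions on the family of constraints `c_x(η)`. -/
structure IsConstraint (c : ℤ → Config → ℝ) : Prop where
  /-- The rates are nonnegative reals. -/
  nonneg : ∀ x η, 0 ≤ c x η
  /-- Translation invariance: `c_x(η) = c_0(η(x + ·))`. -/
  translation : ∀ x η, c x η = c 0 (fun y => η (x + y))
  /-- `c_0` is local. -/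
  isLocal : IsLocal (c 0)
  /-- `c_0(η) = c_0(η^{0,1})`. -/
  exch_symm : ∀ η, c 0 η = c 0 (exch 0 η)
  /-- `c_0(η) > 0` if and only if `η(-1) + η(2) > 0`. -/
  pos_iff : ∀ η, 0 < c 0 η ↔ 0 < occ η (-1) + occ η 2

/-- The generator `ℒ f(η) = ∑_x c_x(η) [f(η^{x,x+1}) - f(η)]`; for local `f` only finitely many
terms are nonzero. -/
noncomputable def generator (c : ℤ → Config → ℝ) (f : Config → ℝ) (η : Config) : ℝ :=
  ∑ᶠ x : ℤ, c x η * (f (exch x η) - f η)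

/-- A stationary measure: a probability measure `ν` with `ν(ℒ f) = 0` for all local `f`. -/
def IsStationary (c : ℤ → Config → ℝ) (ν : Measure Config) : Prop :=
  IsProbabilityMeasure ν ∧ ∀ f : Config → ℝ, IsLocal f → ∫ η, generator c f η ∂ν = 0

/-- The frozen configurations `𝓕`. -/
def frozen : Set Config :=
  {η | ∀ x : ℤ, occ η x = 1 → occ η (x + 1) + occ η (x + 2) = 0}

/-- `𝓕'_k`: the non-frozen configurations with exactly `k` particles. -/
def finParticles (k : ℕ) : Set Config :=
  {η | η ∉ frozen ∧ ∑' x : ℤ, (occ η x : ℝ≥0∞) = k}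

/-- `𝓕' = ⋃_{k ≥ 2} 𝓕'_k`. -/
def setF' : Set Config := ⋃ k ≥ 2, finParticles k

/-- `𝓕''_k`: the non-frozen configurations with exactly `k` empty sites. -/
def finHoles (k : ℕ) : Set Config :=
  {η | η ∉ frozen ∧ ∑' x : ℤ, ((1 - occ η x : ℕ) : ℝ≥0∞) = k}

/-- `𝓕'' = ⋃_{k ≥ 0} 𝓕''_k`. -/
def setF'' : Set Config := ⋃ k, finHoles k

/-- The number `∑_x (η(x) η(x+1) + η(x) η(x+2))` of pairs of particles within distance 2. -/
noncomputable def numPairs (η : Config) : ℝ≥0∞ :=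
  ∑' x : ℤ, ((occ η x * occ η (x + 1) + occ η x * occ η (x + 2) : ℕ) : ℝ≥0∞)

/-- `𝓔'`: the configurations outside `𝓕'` with a finite, positive number of such pairs. -/
def setE' : Set Config := {η | η ∉ setF' ∧ 0 < numPairs η ∧ numPairs η < ∞}

/-- The ergodic set `𝓔`. -/
def ergodicSet : Set Config := (frozen ∪ setF' ∪ setF'' ∪ setE')ᶜ

/-- The configuration with a particle at every site. -/
def full : Config := fun _ => true

/-- The product measure `μ_ρ = ⨂_{x ∈ ℤ} Ber(ρ)`. -/
noncomputable def prodBernoulli (ρ : unitInterval) : Measure Config :=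
  Measure.infinitePi (fun _ : ℤ => bernoulliMeasure true false ρ)

end PorousMedium

/-! Stationarity is upgraded to reversibility, which is then combined with the mobility of pairs of
neighbouring particles.

Reversibility comes from the one-dimensional entropy production argument. Stationarity is tested on
the logarithm of the marginal of `ν` on `[-n, n]`. Interior bonds dissipate at least the Dirichlet
form of the square root of the marginal. Edge bonds, whose number does not grow with `n`, contribute
at most square roots of such forms on a larger window (`sum_bondForm_interior_le`). The forms
increase with the window (`bondForm_mono`), so their limits `D x` have bounded partial sums. Hence
`D` tends to zero at infinity, the edge terms vanish in the limit, and `D = 0` (`bondForm_eq_zero`).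
Thus `ν` is invariant under every allowed exchange (`IsStationary.isReversible`).

A pair travels: for either value `h`, the patterns `h11` and `11h` are linked by two allowed
exchanges. A pair can therefore be brought next to a distant bond, make the exchange there legal,
and return, so on the event of a pair `ν` is invariant under exchanges at bonds disjoint from it
(`exch_right_of_pair`, `exch_left_of_pair`). By de Finetti, the half-line to the right of the pair
is almost surely empty or contains infinitely many pairs. The first case is null, since a last pair
could be moved off to infinity at no loss of mass (`measure_pairAt_diff`). A non-frozen
configuration contains `11` or `101`, and `101` becomes `11` by an allowed exchange. Hence almost
every non-frozen configuration lies in `manyPairs`.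

On `manyPairs` a pair is available beyond any bond, so every exchange preserves `ν`, and de Finetti
yields a mixture of Bernoulli measures. Splitting off the full configuration removes density one,
and density zero has no pairs. The classes `setF'` and `setE'` are disjoint from `manyPairs`, while
`setF''` lies in a countable set whose points are null for every density below one. -/

namespace PorousMedium

/-! ### De Finetti's theorem on `{0,1}^ι` by the method of moments. -/

section DeFinetti

variable {ι : Type*}

/-- The configurations on `ι` with a particle at every site of `I`. -/
def ones (I : Finset ι) : Set (ι → Bool) := {η | ∀ i ∈ I, η i = true}

lemma measurableSet_ones (I : Finset ι) : MeasurableSet (ones I) := by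
  have : ones I = ⋂ i ∈ I, (fun η : ι → Bool => η i) ⁻¹' {true} := by ext η; simp [ones]
  rw [this]
  exact I.measurableSet_biInter fun i _ => measurable_pi_apply i (measurableSet_singleton _)

lemma ones_empty : ones (∅ : Finset ι) = Set.univ := by simp [ones]

lemma ones_inter [DecidableEq ι] (I J : Finset ι) : ones I ∩ ones J = ones (I ∪ J) := by
  ext η
  simp only [ones, Set.mem_inter_iff, Set.mem_ofPred_eq, Finset.mem_union]
  exact ⟨fun h i hi => hi.elim (h.1 i) (h.2 i), fun h => ⟨fun i hi => h i (.inl hi),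
    fun i hi => h i (.inr hi)⟩⟩

lemma isPiSystem_ones : IsPiSystem (Set.range (ones (ι := ι))) := by
  classical
  rintro _ ⟨I, rfl⟩ _ ⟨J, rfl⟩ _
  exact ⟨I ∪ J, (ones_inter I J).symm⟩

lemma generateFrom_ones :
    (inferInstance : MeasurableSpace (ι → Bool)) =
      MeasurableSpace.generateFrom (Set.range (ones (ι := ι))) := by
  apply le_antisymm
  · refine iSup_le fun i => ?_
    rw [← measurable_iff_comap_le]
    refine @measurable_to_bool _ (_) _ ?_
    refine MeasurableSpace.measurableSet_generateFrom ⟨{i}, ?_⟩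
    ext η; simp [ones]
  · refine MeasurableSpace.generateFrom_le ?_
    rintro _ ⟨I, rfl⟩
    exact measurableSet_ones I

/-- A finite measure on `{0,1}^ι` is determined by the probabilities of all-ones cylinders. -/
lemma ext_of_ones {μ ν : Measure (ι → Bool)} [IsFiniteMeasure μ]
    (h : ∀ I : Finset ι, μ (ones I) = ν (ones I)) : μ = ν := by
  refine ext_of_generate_finite _ generateFrom_ones isPiSystem_ones ?_ ?_
  · rintro _ ⟨I, rfl⟩
    exact h I
  · simpa [ones_empty] using h ∅

variable (ι) in
/-- The Bernoulli product measure on `{0,1}^ι`. -/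
noncomputable def bernoulliPi (ρ : unitInterval) : Measure (ι → Bool) :=
  Measure.infinitePi (fun _ : ι => bernoulliMeasure true false ρ)

instance (ρ : unitInterval) : IsProbabilityMeasure (bernoulliPi ι ρ) := by
  unfold bernoulliPi; infer_instance

lemma bernoulliPi_ones (ρ : unitInterval) (I : Finset ι) :
    bernoulliPi ι ρ (ones I) = ENNReal.ofReal ρ ^ I.card := by
  have : ones I = Set.pi (I : Set ι) (fun _ => {true}) := by ext η; simp [ones]
  rw [this, bernoulliPi, Measure.infinitePi_pi _ (fun _ _ => measurableSet_singleton _)]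
  rw [Finset.prod_const, bernoulliMeasure_apply_of_mem_of_notMem _ (measurableSet_singleton _)
    (by simp) (by simp)]
  congr 1
  rw [ENNReal.ofReal, ENNReal.coe_inj]
  ext
  simp [ρ.2.1]

/-- This makes the mixture a legitimate `Measure.bind`. It suffices to check the π-system of
all-ones cylinders, where the mass is a power of `ρ`. -/
lemma measurable_bernoulliPi : Measurable (bernoulliPi ι) := by
  refine Measurable.measure_of_isPiSystem_of_isProbabilityMeasure generateFrom_ones
    isPiSystem_ones ?_
  rintro _ ⟨I, rfl⟩
  simp only [bernoulliPi_ones]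
  fun_prop

/-- The fraction of particles among the first `n` sites of an enumeration. -/
noncomputable def meanOcc (e : ℕ ↪ ι) (n : ℕ) (η : ι → Bool) : ℝ :=
  (∑ i ∈ Finset.range n, (ones {e i}).indicator (fun _ => (1 : ℝ)) η) / n

lemma meanOcc_mem (e : ℕ ↪ ι) (n : ℕ) (η : ι → Bool) : meanOcc e n η ∈ unitInterval := by
  unfold meanOcc
  have h0 : ∀ i, 0 ≤ (ones {e i}).indicator (fun _ => (1 : ℝ)) η := fun i =>
    Set.indicator_nonneg (fun _ _ => zero_le_one) _
  have h1 : ∀ i, (ones {e i}).indicator (fun _ => (1 : ℝ)) η ≤ 1 := fun i =>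
    Set.indicator_le_self' (fun _ _ => zero_le_one) _
  refine ⟨div_nonneg (Finset.sum_nonneg fun i _ => h0 i) (Nat.cast_nonneg _), ?_⟩
  refine div_le_one_of_le₀ ?_ (Nat.cast_nonneg _)
  simpa using Finset.sum_le_card_nsmul (Finset.range n) _ 1 (fun i _ => h1 i)

lemma measurable_meanOcc (e : ℕ ↪ ι) (n : ℕ) : Measurable (meanOcc e n) := by
  unfold meanOcc
  refine Measurable.div_const (Finset.measurable_fun_sum _ fun i _ => ?_) _
  exact measurable_const.indicator (measurableSet_ones _)

lemma indicator_mul_meanOcc_pow_mem (e : ℕ ↪ ι) (n k : ℕ) (I : Finset ι) (η : ι → Bool) :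
    (ones I).indicator (fun _ => (1 : ℝ)) η * meanOcc e n η ^ k ∈ unitInterval := by
  refine unitInterval.mul_mem ?_ ⟨pow_nonneg (meanOcc_mem e n η).1 k,
    pow_le_one₀ (meanOcc_mem e n η).1 (meanOcc_mem e n η).2⟩
  exact ⟨Set.indicator_nonneg (fun _ _ => zero_le_one) _,
    Set.indicator_le_self' (fun _ _ => zero_le_one) _⟩

lemma integrable_indicator_mul_meanOcc_pow (P : Measure (ι → Bool)) [IsProbabilityMeasure P]
    (e : ℕ ↪ ι) (n k : ℕ) (I : Finset ι) :
    Integrable (fun η => (ones I).indicator (fun _ => (1 : ℝ)) η * meanOcc e n η ^ k) P := by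
  refine Integrable.of_bound (C := 1) ?_ (ae_of_all _ fun η => ?_)
  · exact ((measurable_const.indicator (measurableSet_ones _)).mul
      ((measurable_meanOcc e n).pow_const k)).aestronglyMeasurable
  · have := indicator_mul_meanOcc_pow_mem e n k I η
    rw [Real.norm_eq_abs, abs_of_nonneg this.1]
    exact this.2

lemma integral_indicator_mul_meanOcc_pow_mem (P : Measure (ι → Bool)) [IsProbabilityMeasure P]
    (e : ℕ ↪ ι) (n k : ℕ) (I : Finset ι) :
    ∫ η, (ones I).indicator (fun _ => (1 : ℝ)) η * meanOcc e n η ^ k ∂P ∈ unitInterval := by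
  refine ⟨integral_nonneg fun η => (indicator_mul_meanOcc_pow_mem e n k I η).1, ?_⟩
  have := integral_mono (integrable_indicator_mul_meanOcc_pow P e n k I)
    (integrable_const (1 : ℝ)) (fun η => (indicator_mul_meanOcc_pow_mem e n k I η).2)
  simpa using this

/-- Expanding one factor of the empirical density adds one site `e i` to `I`. Unless `e i` already
lies in `I`, which happens for at most `a` indices, this reduces the exponent by one at the price of
one more site. The constant must be uniform in `I` for this induction to close. -/
lemma abs_integral_meanOcc_pow_sub_le [DecidableEq ι] (P : Measure (ι → Bool))
    [IsProbabilityMeasure P] (e : ℕ ↪ ι) (m : ℕ → ℝ) (hm : ∀ I, P.real (ones I) = m I.card)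
    (k : ℕ) : ∀ a : ℕ, ∃ C : ℝ, ∀ I : Finset ι, I.card = a → ∀ n : ℕ, 0 < n →
      |∫ η, (ones I).indicator (fun _ => (1 : ℝ)) η * meanOcc e n η ^ k ∂P - m (a + k)|
        ≤ C / n := by
  have hm01 : ∀ j, m j ∈ unitInterval := fun j => by
    obtain ⟨I, hI⟩ : ∃ I : Finset ι, I.card = j :=
      ⟨(Finset.range j).map e, by simp⟩
    rw [← hI, ← hm]
    exact ⟨measureReal_nonneg, measureReal_le_one⟩
  induction k with
  | zero =>
    refine fun a => ⟨0, fun I hI n _ => ?_⟩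
    simp only [pow_zero, mul_one]
    rw [integral_indicator_const _ (measurableSet_ones _), hm, hI]
    simp
  | succ k ih =>
    intro a
    obtain ⟨C, hC⟩ := ih (a + 1)
    -- The summand `a` pays for the coincidences `e i ∈ I`, each an error of at most one; `C` is the
    -- inductive constant for `a + 1` sites.
    refine ⟨a + C, fun I hI n hn => ?_⟩
    have hn' : (0 : ℝ) < n := by exact_mod_cast hn
    have hpt : ∀ η, (ones I).indicator (fun _ => (1 : ℝ)) η * meanOcc e n η ^ (k + 1) =
        (∑ i ∈ Finset.range n, (ones (insert (e i) I)).indicator (fun _ => (1 : ℝ)) η *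
          meanOcc e n η ^ k) / n := by
      intro η
      rw [← Finset.sum_mul, pow_succ]
      have : ∑ i ∈ Finset.range n, (ones (insert (e i) I)).indicator (fun _ => (1 : ℝ)) η =
          (ones I).indicator (fun _ => (1 : ℝ)) η * (n * meanOcc e n η) := by
        rw [meanOcc, mul_div_cancel₀ _ hn'.ne', Finset.mul_sum]
        refine Finset.sum_congr rfl fun i _ => ?_
        rw [Finset.insert_eq, ← ones_inter]
        by_cases h1 : η ∈ ones I <;> by_cases h2 : η ∈ ones {e i} <;> simp [h1, h2]
      rw [this]
      field_simp
    simp_rw [hpt]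
    rw [integral_div, integral_finsetSum _
      (fun i _ => integrable_indicator_mul_meanOcc_pow P e n k _)]
    set u : ℕ → ℝ := fun i => ∫ η, (ones (insert (e i) I)).indicator (fun _ => (1 : ℝ)) η *
      meanOcc e n η ^ k ∂P with hu
    have hterm : ∀ i ∈ Finset.range n, |u i - m (a + (k + 1))| ≤
        (if e i ∈ I then 1 else 0) + C / n := by
      have hCn : 0 ≤ C / n := by
        obtain ⟨J, hJ⟩ : ∃ J : Finset ι, J.card = a + 1 := ⟨(Finset.range (a + 1)).map e, by simp⟩
        exact (abs_nonneg _).trans (hC J hJ n hn)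
      intro i _
      split_ifs with hi
      · have h1 := integral_indicator_mul_meanOcc_pow_mem P e n k (insert (e i) I)
        have h2 := hm01 (a + (k + 1))
        have : |u i - m (a + (k + 1))| ≤ 1 := by
          rw [abs_le]; constructor <;> simp only [hu] <;> linarith [h1.1, h1.2, h2.1, h2.2]
        linarith
      · have := hC (insert (e i) I) (by rw [Finset.card_insert_of_notMem hi, hI]) n hn
        rw [show a + 1 + k = a + (k + 1) by ring] at this
        linarith
    have hcount : ∑ i ∈ Finset.range n, (if e i ∈ I then (1 : ℝ) else 0) ≤ a := by
      rw [Finset.sum_boole]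
      have : (Finset.filter (fun i => e i ∈ I) (Finset.range n)).card ≤ I.card :=
        Finset.card_le_card_of_injOn e (fun i hi => by simpa using (Finset.mem_filter.1 hi).2)
          (e.injective.injOn)
      rw [hI] at this
      exact_mod_cast this
    have hrw : (∑ i ∈ Finset.range n, u i) / n - m (a + (k + 1)) =
        (∑ i ∈ Finset.range n, (u i - m (a + (k + 1)))) / n := by
      rw [Finset.sum_sub_distrib]
      simp only [Finset.sum_const, Finset.card_range, nsmul_eq_mul]
      field_simp
    rw [hrw, abs_div, abs_of_pos hn']
    gcongr
    calc _ ≤ ∑ i ∈ Finset.range n, |u i - m (a + (k + 1))| := Finset.abs_sum_le_sum_abs _ _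
      _ ≤ ∑ i ∈ Finset.range n, ((if e i ∈ I then (1 : ℝ) else 0) + C / n) :=
          Finset.sum_le_sum hterm
      _ ≤ a + C := by
          rw [Finset.sum_add_distrib]
          simp only [Finset.sum_const, Finset.card_range, nsmul_eq_mul]
          rw [mul_div_cancel₀ _ hn'.ne']
          linarith

open Filter Topology in
/-- De Finetti's theorem for probability measures on `{0,1}^ι`. -/
theorem exists_mixture_of_exchangeable_prob [Infinite ι] (P : Measure (ι → Bool))
    [IsProbabilityMeasure P]
    (h : ∀ I J : Finset ι, I.card = J.card → P (ones I) = P (ones J)) :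
    ∃ lam : Measure unitInterval, IsProbabilityMeasure lam ∧ P = lam.bind (bernoulliPi ι) := by
  classical
  let e : ℕ ↪ ι := Infinite.natEmbedding ι
  let m : ℕ → ℝ := fun j => P.real (ones ((Finset.range j).map e))
  have hm : ∀ I, P.real (ones I) = m I.card := fun I => by
    simp only [m, measureReal_def]
    rw [h I ((Finset.range I.card).map e) (by simp)]
  let X : ℕ → (ι → Bool) → unitInterval := fun n η => ⟨meanOcc e n η, meanOcc_mem e n η⟩
  have hX : ∀ n, Measurable (X n) := fun n => (measurable_meanOcc e n).subtype_mk
  let L : ℕ → ProbabilityMeasure unitInterval := fun n =>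
    ⟨P.map (X n), Measure.isProbabilityMeasure_map (hX n).aemeasurable⟩
  -- The laws of the empirical densities lie in a compact space, so they converge along a free
  -- ultrafilter. Only the moments of the limit matter, because `bernoulliPi_ones` is a monomial in
  -- `ρ`.
  obtain ⟨lam, -, hlam⟩ := isCompact_univ.ultrafilter_le_nhds ((hyperfilter ℕ).map L)
    (by simp)
  have htend : Tendsto L (hyperfilter ℕ) (𝓝 lam) := hlam
  rw [ProbabilityMeasure.tendsto_iff_forall_integral_tendsto] at htend
  have hmom : ∀ k : ℕ, ∫ ρ : unitInterval, (ρ : ℝ) ^ k ∂(lam : Measure unitInterval) = m k := by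
    intro k
    let g : BoundedContinuousFunction unitInterval ℝ :=
      BoundedContinuousFunction.mkOfCompact ⟨fun ρ : unitInterval => (ρ : ℝ) ^ k, by fun_prop⟩
    have h1 := htend g
    have h2 : Tendsto (fun n => ∫ ρ, g ρ ∂(L n : Measure unitInterval)) atTop (𝓝 (m k)) := by
      obtain ⟨C, hC⟩ := abs_integral_meanOcc_pow_sub_le P e m hm k 0
      have h3 : Tendsto (fun n : ℕ => C / (n : ℝ)) atTop (𝓝 0) :=
        tendsto_const_div_atTop_nhds_zero_nat C
      rw [tendsto_iff_dist_tendsto_zero]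
      refine squeeze_zero' (Eventually.of_forall fun _ => dist_nonneg) ?_ h3
      filter_upwards [eventually_gt_atTop 0] with n hn
      have := hC ∅ rfl n hn
      rw [Real.dist_eq]
      convert this using 3
      · change ∫ ρ, g ρ ∂(P.map (X n)) = _
        rw [integral_map (hX n).aemeasurable g.continuous.aestronglyMeasurable]
        refine integral_congr_ae (ae_of_all _ fun η => ?_)
        simp [g, X, ones_empty]
      · simp
    exact tendsto_nhds_unique h1 (h2.mono_left Nat.hyperfilter_le_atTop)
  refine ⟨lam, inferInstance, ext_of_ones fun I => ?_⟩
  rw [Measure.bind_apply (measurableSet_ones I) measurable_bernoulliPi.aemeasurable]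
  simp only [bernoulliPi_ones]
  have h1 : P (ones I) = ENNReal.ofReal (m I.card) := by rw [← hm]; simp
  rw [h1, ← hmom, ofReal_integral_eq_lintegral_ofReal]
  · refine lintegral_congr fun ρ => ?_
    rw [ENNReal.ofReal_pow ρ.2.1]
  · refine Integrable.of_bound (C := 1) (by fun_prop) (ae_of_all _ fun ρ => ?_)
    rw [Real.norm_eq_abs, abs_of_nonneg (pow_nonneg ρ.2.1 _)]
    exact pow_le_one₀ ρ.2.1 ρ.2.2
  · exact ae_of_all _ fun ρ => pow_nonneg ρ.2.1 _

/-- De Finetti's theorem for finite measures on `{0,1}^ι`. -/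
theorem exists_mixture_of_exchangeable [Infinite ι] (μ : Measure (ι → Bool)) [IsFiniteMeasure μ]
    (h : ∀ I J : Finset ι, I.card = J.card → μ (ones I) = μ (ones J)) :
    ∃ lam : Measure unitInterval, IsFiniteMeasure lam ∧
      ∀ A, MeasurableSet A → μ A = ∫⁻ ρ, bernoulliPi ι ρ A ∂lam := by
  rcases eq_or_ne μ 0 with rfl | hμ
  · exact ⟨0, inferInstance, by simp⟩
  have hμ0 : μ Set.univ ≠ 0 := by simpa using hμ
  have : NeZero μ := ⟨hμ⟩
  obtain ⟨lam, hlam, heq⟩ := exists_mixture_of_exchangeable_prob ((μ Set.univ)⁻¹ • μ)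
    (fun I J hIJ => by simp [h I J hIJ])
  refine ⟨μ Set.univ • lam, ⟨by simp⟩, fun A hA => ?_⟩
  rw [lintegral_smul_measure, ← Measure.bind_apply hA measurable_bernoulliPi.aemeasurable, ← heq]
  simp only [Measure.smul_apply, smul_eq_mul]
  rw [← mul_assoc, ENNReal.mul_inv_cancel hμ0 (measure_ne_top _ _), one_mul]

end DeFinetti

end PorousMedium

namespace PorousMedium

/-! ### Marginals on finite windows, exchanges and flips. -/

section Windows

open Classical in
/-- The configurations supported in the window `M`. -/
noncomputable def winConf (M : Finset ℤ) : Finset Config :=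
  M.powerset.image fun S y => decide (y ∈ S)

lemma mem_winConf {M : Finset ℤ} {η : Config} : η ∈ winConf M ↔ ∀ y ∉ M, η y = false := by
  simp only [winConf, Finset.mem_image, Finset.mem_powerset]
  constructor
  · rintro ⟨S, hS, rfl⟩ y hy
    simpa using fun h => hy (hS h)
  · intro h
    refine ⟨M.filter fun y => η y = true, Finset.filter_subset _ _, ?_⟩
    funext y
    by_cases hy : y ∈ M
    · simp [hy]
    · simp [hy, h y hy]

/-- The restriction of `η` to `M`, empty outside. -/
def trunc (M : Finset ℤ) (η : Config) : Config := fun y => decide (y ∈ M) && η y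

lemma trunc_mem (M : Finset ℤ) (η : Config) : trunc M η ∈ winConf M :=
  mem_winConf.2 fun y hy => by simp [trunc, hy]

lemma trunc_apply {M : Finset ℤ} {y : ℤ} (hy : y ∈ M) (η : Config) : trunc M η y = η y := by
  simp [trunc, hy]

lemma DependsOn.trunc {β : Type*} {M : Finset ℤ} {F : Config → β}
    (hF : DependsOn F (M : Set ℤ)) (η : Config) : F (trunc M η) = F η :=
  hF fun y hy => trunc_apply (by simpa using hy) η

/-- The cylinder of the configurations that agree with `η` on `M`. -/
def cyl (M : Finset ℤ) (η : Config) : Set Config := {ω | ∀ y ∈ M, ω y = η y}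

lemma measurableSet_cyl (M : Finset ℤ) (η : Config) : MeasurableSet (cyl M η) := by
  have : cyl M η = ⋂ i ∈ M, (fun ω : Config => ω i) ⁻¹' {η i} := by ext ω; simp [cyl]
  rw [this]
  exact M.measurableSet_biInter fun i _ => measurable_pi_apply i (measurableSet_singleton _)

lemma mem_cyl_iff_trunc {M : Finset ℤ} {η ω : Config} (hη : η ∈ winConf M) :
    ω ∈ cyl M η ↔ η = trunc M ω := by
  constructor
  · intro h
    funext y
    by_cases hy : y ∈ M
    · rw [trunc_apply hy, h y hy]
    · rw [mem_winConf.1 hη y hy, mem_winConf.1 (trunc_mem M ω) y hy]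
  · rintro rfl y hy
    exact (trunc_apply hy ω).symm

/-- The marginal weight of `η` on the window `M`. -/
noncomputable def marg (ν : Measure Config) (M : Finset ℤ) (η : Config) : ℝ := ν.real (cyl M η)

lemma marg_nonneg (ν : Measure Config) (M : Finset ℤ) (η : Config) : 0 ≤ marg ν M η :=
  measureReal_nonneg

lemma dependsOn_marg (ν : Measure Config) (M : Finset ℤ) :
    DependsOn (marg ν M) (M : Set ℤ) := by
  intro η ω h
  have : cyl M η = cyl M ω := by
    ext ξ
    exact forall₂_congr fun y hy => by rw [h y (by simpa using hy)]
  rw [marg, marg, this]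

/-- The sum of `F` over the configurations supported in `M`. -/
noncomputable def winSum (M : Finset ℤ) (F : Config → ℝ) : ℝ := ∑ η ∈ winConf M, F η

lemma eq_sum_indicator_cyl {M : Finset ℤ} {F : Config → ℝ} (hF : DependsOn F (M : Set ℤ))
    (ω : Config) :
    F ω = ∑ η ∈ winConf M, (cyl M η).indicator (fun _ => F η) ω := by
  rw [Finset.sum_eq_single (trunc M ω)]
  · rw [Set.indicator_of_mem ((mem_cyl_iff_trunc (trunc_mem M ω)).2 rfl), DependsOn.trunc hF]
  · intro η hη hne
    exact Set.indicator_of_notMem (fun h => hne ((mem_cyl_iff_trunc hη).1 h)) _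
  · exact fun h => absurd (trunc_mem M ω) h

lemma integrable_of_dependsOn (ν : Measure Config) [IsProbabilityMeasure ν] {M : Finset ℤ} {F : Config → ℝ} (hF : DependsOn F (M : Set ℤ)) :
    Integrable F ν := by
  rw [funext (eq_sum_indicator_cyl hF)]
  exact integrable_finsetSum _ fun η _ =>
    (integrable_const _).indicator (measurableSet_cyl M η)

lemma integral_eq_winSum (ν : Measure Config) [IsProbabilityMeasure ν] {M : Finset ℤ} {F : Config → ℝ} (hF : DependsOn F (M : Set ℤ)) :
    ∫ ω, F ω ∂ν = winSum M fun η => F η * marg ν M η := by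
  conv_lhs => rw [funext (eq_sum_indicator_cyl hF)]
  rw [integral_finsetSum _ fun η _ => (integrable_const _).indicator (measurableSet_cyl M η)]
  refine Finset.sum_congr rfl fun η _ => ?_
  rw [integral_indicator_const _ (measurableSet_cyl M η), smul_eq_mul]
  exact mul_comm _ _

/-- Consistency of the marginals: both sides are the integral of `F`. It is the device by which
expressions linear in the marginal pass from one window to another. -/
lemma winSum_marg_of_subset (ν : Measure Config) [IsProbabilityMeasure ν] {L M : Finset ℤ} (hLM : L ⊆ M) {F : Config → ℝ}
    (hF : DependsOn F (L : Set ℤ)) :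
    winSum M (fun η => F η * marg ν M η) = winSum L fun η => F η * marg ν L η := by
  rw [← integral_eq_winSum ν hF, ← integral_eq_winSum ν (hF.mono (by exact_mod_cast hLM))]

lemma winSum_marg (ν : Measure Config) [IsProbabilityMeasure ν] (M : Finset ℤ) : winSum M (marg ν M) = 1 := by
  have := integral_eq_winSum ν (M := M) (F := fun _ => (1 : ℝ)) (fun _ _ _ => rfl)
  simpa using this.symm

lemma winSum_comp_involution {M : Finset ℤ} {τ : Config → Config} (hτ : Function.Involutive τ)
    (hM : ∀ η ∈ winConf M, τ η ∈ winConf M) (F : Config → ℝ) :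
    winSum M (fun η => F (τ η)) = winSum M F :=
  Finset.sum_nbij' τ τ hM hM (fun η _ => hτ η) (fun η _ => hτ η) (fun _ _ => rfl)

lemma winSum_mono {M : Finset ℤ} {F G : Config → ℝ} (h : ∀ η, F η ≤ G η) :
    winSum M F ≤ winSum M G := Finset.sum_le_sum fun η _ => h η

lemma winSum_nonneg {M : Finset ℤ} {F : Config → ℝ} (h : ∀ η, 0 ≤ F η) : 0 ≤ winSum M F :=
  Finset.sum_nonneg fun η _ => h η

lemma winSum_add (M : Finset ℤ) (F G : Config → ℝ) :
    winSum M (fun η => F η + G η) = winSum M F + winSum M G := Finset.sum_add_distrib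

lemma winSum_const_mul (M : Finset ℤ) (a : ℝ) (F : Config → ℝ) :
    winSum M (fun η => a * F η) = a * winSum M F := (Finset.mul_sum ..).symm

lemma exch_apply (x y : ℤ) (η : Config) : exch x η y = η (Equiv.swap x (x + 1) y) := rfl

lemma exch_involutive (x : ℤ) : Function.Involutive (exch x) := fun η => by
  funext y; simp [exch_apply]

@[simp] lemma exch_exch (x : ℤ) (η : Config) : exch x (exch x η) = η := exch_involutive x η

@[simp] lemma exch_left (x : ℤ) (η : Config) : exch x η x = η (x + 1) := by simp [exch_apply]

@[simp] lemma exch_right (x : ℤ) (η : Config) : exch x η (x + 1) = η x := by simp [exch_apply]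

lemma exch_of_ne {x y : ℤ} (h : y ≠ x) (h' : y ≠ x + 1) (η : Config) : exch x η y = η y := by
  rw [exch_apply, Equiv.swap_apply_of_ne_of_ne h h']

lemma measurable_exch (x : ℤ) : Measurable (exch x) :=
  measurable_pi_lambda _ fun _ => measurable_pi_apply _

lemma exch_mem_winConf {M : Finset ℤ} {x : ℤ} (hx : x ∈ M) (hx' : x + 1 ∈ M) :
    ∀ η ∈ winConf M, exch x η ∈ winConf M := by
  intro η hη
  rw [mem_winConf] at hη ⊢
  intro y hy
  rw [exch_of_ne (by rintro rfl; exact hy hx) (by rintro rfl; exact hy hx')]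
  exact hη y hy

lemma DependsOn.exch {β : Type*} {M : Finset ℤ} {F : Config → β}
    (hF : DependsOn F (M : Set ℤ)) {x : ℤ} (hx : x ∈ M) (hx' : x + 1 ∈ M) :
    DependsOn (fun η => F (exch x η)) (M : Set ℤ) := by
  intro η ω h
  refine hF fun y hy => ?_
  by_cases h1 : y = x
  · subst h1; simpa using h _ (by simpa using hx')
  by_cases h2 : y = x + 1
  · subst h2; simpa using h _ (by simpa using hx)
  rw [exch_of_ne h1 h2, exch_of_ne h1 h2]
  exact h y hy

lemma winSum_exch {M : Finset ℤ} {x : ℤ} (hx : x ∈ M) (hx' : x + 1 ∈ M) (F : Config → ℝ) :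
    winSum M (fun η => F (exch x η)) = winSum M F :=
  winSum_comp_involution (exch_involutive x) (exch_mem_winConf hx hx') F

/-- The configuration `η` with the content of `y` changed. -/
def flipAt (y : ℤ) (η : Config) : Config := Function.update η y (!η y)

lemma flipAt_involutive (y : ℤ) : Function.Involutive (flipAt y) := fun η => by
  funext z
  by_cases h : z = y
  · subst h; simp [flipAt]
  · simp [flipAt, h]

lemma flipAt_mem_winConf {M : Finset ℤ} {y : ℤ} (hy : y ∈ M) :
    ∀ η ∈ winConf M, flipAt y η ∈ winConf M := by
  intro η hη
  rw [mem_winConf] at hη ⊢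
  intro z hz
  rw [flipAt, Function.update_of_ne (by rintro rfl; exact hz hy)]
  exact hη z hz

lemma DependsOn.flipAt {β : Type*} {M : Finset ℤ} {F : Config → β}
    (hF : DependsOn F (M : Set ℤ)) (y : ℤ) :
    DependsOn (fun η => F (flipAt y η)) (M : Set ℤ) := by
  intro η ω h
  refine hF fun z hz => ?_
  by_cases h1 : z = y
  · subst h1; simp [PorousMedium.flipAt, h z hz]
  · simp [PorousMedium.flipAt, h1, h z hz]

end Windows

end PorousMedium

namespace PorousMedium

/-! ### Entropy production and Dirichlet forms on windows. -/

section Entropy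

/-- Pointwise dissipation at an interior bond, obtained from `log t ≤ t - 1` at `t = √v / √u`. -/
lemma log_sub_mul_sub_le {u v : ℝ} (hu : 0 < u) (hv : 0 < v) :
    (Real.log v - Real.log u) * (u - v) ≤ -(√u - √v) ^ 2 := by
  wlog h : v ≤ u generalizing u v
  · have := this hv hu (le_of_not_ge h)
    nlinarith
  have hs : 0 < √u := Real.sqrt_pos.2 hu
  have ht : 0 < √v := Real.sqrt_pos.2 hv
  have hts : √v ≤ √u := Real.sqrt_le_sqrt h
  have hlog : Real.log v - Real.log u ≤ 2 * (√v / √u - 1) := by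
    have h1 := Real.log_le_sub_one_of_pos (div_pos ht hs)
    rw [Real.log_div ht.ne' hs.ne', Real.log_sqrt hv.le, Real.log_sqrt hu.le] at h1
    linarith
  have huv : u - v = (√u - √v) * (√u + √v) := by
    have := Real.sq_sqrt hu.le; have := Real.sq_sqrt hv.le; nlinarith
  calc _ ≤ 2 * (√v / √u - 1) * (u - v) := by gcongr
    _ = -(√u - √v) ^ 2 * (2 * (√u + √v) / √u) := by rw [huv]; field_simp; ring
    _ ≤ -(√u - √v) ^ 2 * 1 := by
        rw [neg_mul, neg_mul]
        refine neg_le_neg (mul_le_mul_of_nonneg_left ?_ (sq_nonneg _))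
        rw [le_div_iff₀ hs]; linarith
    _ = _ := by ring

/-- Used at edge bonds, where the logarithm comes from the small window and `p`, `q` from the large
one. For `q ≤ p` it combines `log (b / a) ≤ 2 * √(b / a)` with `p - q ≤ 2 * √p * (√p - √q)`. The
factor `|√p - √q|` is kept so that Cauchy–Schwarz produces a Dirichlet form. -/
lemma log_sub_mul_sub_le_sqrt {p q a b : ℝ} (hp : 0 ≤ p) (hq : 0 ≤ q) (ha : 0 < a) (hb : 0 < b) :
    (Real.log b - Real.log a) * (p - q) ≤
      4 * (|√p - √q| * (√p * √(b / a) + √q * √(a / b))) := by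
  wlog h : q ≤ p generalizing p q a b
  · have := this hq hp hb ha (le_of_not_ge h)
    rw [abs_sub_comm] at this
    linarith
  have hts : √q ≤ √p := Real.sqrt_le_sqrt h
  have hlog : Real.log b - Real.log a ≤ 2 * √(b / a) := by
    have h0 : 0 < b / a := div_pos hb ha
    have h1 := Real.log_le_sub_one_of_pos (Real.sqrt_pos.2 h0)
    rw [Real.log_sqrt h0.le, Real.log_div hb.ne' ha.ne'] at h1
    linarith
  have hpq : p - q = (√p - √q) * (√p + √q) := by
    have := Real.sq_sqrt hp; have := Real.sq_sqrt hq; nlinarith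
  rw [abs_of_nonneg (sub_nonneg.2 hts)]
  have h0 : 0 ≤ √p - √q := sub_nonneg.2 hts
  calc _ ≤ 2 * √(b / a) * (p - q) := by gcongr
    _ = 2 * √(b / a) * ((√p - √q) * (√p + √q)) := by rw [hpq]
    _ ≤ 2 * √(b / a) * ((√p - √q) * (√p + √p)) := by gcongr
    _ = 4 * ((√p - √q) * (√p * √(b / a) + 0)) := by ring
    _ ≤ _ := by gcongr; positivity

/-- The Dirichlet form of the square root of the density of `ν` on the window `M`, at the
bond `{x, x + 1}` with rate `k`. -/
noncomputable def bondForm (ν : Measure Config) (k : Config → ℝ) (x : ℤ) (M : Finset ℤ) : ℝ :=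
  winSum M fun η => k η * (√(marg ν M η) - √(marg ν M (exch x η))) ^ 2

variable {k : Config → ℝ} {x : ℤ} {L M : Finset ℤ}

lemma bondForm_nonneg (ν : Measure Config) (hk : ∀ η, 0 ≤ k η) : 0 ≤ bondForm ν k x M :=
  winSum_nonneg fun η => mul_nonneg (hk η) (sq_nonneg _)

lemma bondForm_le (ν : Measure Config) [IsProbabilityMeasure ν] {K : ℝ} (hk : ∀ η, 0 ≤ k η)
    (hK : ∀ η, k η ≤ K) (hx : x ∈ M) (hx' : x + 1 ∈ M) : bondForm ν k x M ≤ K * 2 := by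
  have h1 : bondForm ν k x M ≤
      winSum M fun η => K * (marg ν M η + marg ν M (exch x η)) := by
    refine winSum_mono fun η => ?_
    refine mul_le_mul (hK η) ?_ (sq_nonneg _) ((hk η).trans (hK η))
    have h1 := Real.sq_sqrt (marg_nonneg ν M η)
    have h2 := Real.sq_sqrt (marg_nonneg ν M (exch x η))
    have := mul_nonneg (Real.sqrt_nonneg (marg ν M η)) (Real.sqrt_nonneg (marg ν M (exch x η)))
    nlinarith
  rw [winSum_const_mul, winSum_add, winSum_exch hx hx' (marg ν M), winSum_marg] at h1
  linarith

/-- Variational argument: `(√p - √p') ^ 2` dominates `p * (1 - s' / s) + p' * (1 - s / s')` for all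
positive `s`, `s'`, almost with equality at the regularised square roots of the small marginals. The
lower bound is linear in the marginal and tested by a function local to `L`, so it has the same
value on both windows. -/
lemma bondForm_mono (ν : Measure Config) [IsProbabilityMeasure ν] (hk : ∀ η, 0 ≤ k η)
    (hsymm : ∀ η, k (exch x η) = k η) (hkL : DependsOn k (L : Set ℤ)) (hLM : L ⊆ M)
    (hx : x ∈ L) (hx' : x + 1 ∈ L) : bondForm ν k x L ≤ bondForm ν k x M := by
  set P := marg ν L
  set p := marg ν M
  have hPdep : DependsOn P (L : Set ℤ) := dependsOn_marg ν L
  have hP : ∀ η, 0 ≤ P η := marg_nonneg ν L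
  have key : ∀ ε : ℝ, 0 < ε → winSum L (fun η => k η * (P η + P (exch x η) -
      √(P η) * √(P (exch x η) + ε) - √(P (exch x η)) * √(P η + ε))) ≤ bondForm ν k x M := by
    intro ε hε
    -- The shift by `ε` permits division where `P` vanishes; it is removed by continuity at the end.
    let s : Config → ℝ := fun η => √(P η + ε)
    have hs : ∀ η, 0 < s η := fun η => Real.sqrt_pos.2 (by linarith [hP η])
    have hsdep : DependsOn s (L : Set ℤ) := fun η ω h => by simp only [s]; rw [hPdep h]
    let G : Config → ℝ := fun η => k η * (1 - s (exch x η) / s η)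
    have hG : DependsOn G (L : Set ℤ) := fun η ω h => by
      simp only [G]; rw [hkL h, hsdep h, show s (exch x η) = s (exch x ω) from DependsOn.exch hsdep hx hx' h]
    have hswap : ∀ (N : Finset ℤ), x ∈ N → x + 1 ∈ N → ∀ q : Config → ℝ,
        winSum N (fun η => k η * (q η * (1 - s (exch x η) / s η) +
          q (exch x η) * (1 - s η / s (exch x η)))) = 2 * winSum N (fun η => G η * q η) := by
      intro N h1 h2 q
      have : (fun η => k η * (q η * (1 - s (exch x η) / s η) +
          q (exch x η) * (1 - s η / s (exch x η)))) =
          fun η => G η * q η + G (exch x η) * q (exch x η) := by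
        funext η; simp only [G, hsymm, exch_exch]; ring
      rw [this, winSum_add, winSum_exch h1 h2 (fun η => G η * q η)]
      ring
    calc _ ≤ winSum L (fun η => k η * (P η * (1 - s (exch x η) / s η) +
          P (exch x η) * (1 - s η / s (exch x η)))) := by
          refine winSum_mono fun η => mul_le_mul_of_nonneg_left ?_ (hk η)
          have aux : ∀ ω : Config, P ω / s ω ≤ √(P ω) := fun ω => by
            rw [div_le_iff₀ (hs ω)]
            calc P ω = √(P ω) * √(P ω) := (Real.mul_self_sqrt (hP ω)).symm
              _ ≤ _ := mul_le_mul_of_nonneg_left (Real.sqrt_le_sqrt (by linarith))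
                (Real.sqrt_nonneg _)
          have h1 : P η * (s (exch x η) / s η) ≤ √(P η) * s (exch x η) := by
            have := mul_le_mul_of_nonneg_right (aux η) (hs (exch x η)).le
            calc _ = P η / s η * s (exch x η) := by ring
              _ ≤ _ := this
          have h2 : P (exch x η) * (s η / s (exch x η)) ≤ √(P (exch x η)) * s η := by
            have := mul_le_mul_of_nonneg_right (aux (exch x η)) (hs η).le
            calc _ = P (exch x η) / s (exch x η) * s η := by ring
              _ ≤ _ := this
          simp only [s] at h1 h2 ⊢
          linarith
      _ = winSum M (fun η => k η * (p η * (1 - s (exch x η) / s η) +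
          p (exch x η) * (1 - s η / s (exch x η)))) := by
          rw [hswap L hx hx', hswap M (hLM hx) (hLM hx'), winSum_marg_of_subset ν hLM hG]
      _ ≤ _ := by
          refine winSum_mono fun η => mul_le_mul_of_nonneg_left ?_ (hk η)
          have h1 := Real.sq_sqrt (marg_nonneg ν M η)
          have h2 := Real.sq_sqrt (marg_nonneg ν M (exch x η))
          have h3 := hs η
          have h4 := hs (exch x η)
          -- Arithmetic–geometric mean inequality for `p * s' / s` and `p' * s / s'`, whose product
          -- is `p * p'`.
          have h5 : 0 ≤ (√(p η) * s (exch x η) - √(p (exch x η)) * s η) ^ 2 /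
            (s η * s (exch x η)) := by positivity
          have h6 : (√(p η) * s (exch x η) - √(p (exch x η)) * s η) ^ 2 /
              (s η * s (exch x η)) = p η * (s (exch x η) / s η) +
              p (exch x η) * (s η / s (exch x η)) - 2 * √(p η) * √(p (exch x η)) := by
            rw [sub_sq, mul_pow, mul_pow, show √(p η) ^ 2 = p η from h1,
              show √(p (exch x η)) ^ 2 = p (exch x η) from h2]
            field_simp
            ring
          have h7 : √(p η) ^ 2 = p η := h1
          have h8 : √(p (exch x η)) ^ 2 = p (exch x η) := h2
          rw [h6] at h5
          rw [sub_sq, h7, h8]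
          linarith
  have hcont : Continuous fun ε : ℝ => winSum L (fun η => k η * (P η + P (exch x η) -
      √(P η) * √(P (exch x η) + ε) - √(P (exch x η)) * √(P η + ε))) := by
    unfold winSum; fun_prop
  have hlim := (hcont.tendsto 0).mono_left (nhdsWithin_le_nhds (s := Set.Ioi 0))
  have := le_of_tendsto hlim (Filter.eventually_of_mem self_mem_nhdsWithin key)
  refine le_trans (le_of_eq ?_) this
  refine Finset.sum_congr rfl fun η _ => ?_
  have h1 := Real.sq_sqrt (hP η)
  have h2 := Real.sq_sqrt (hP (exch x η))
  simp only [add_zero]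
  congr 1
  nlinarith

/-- Summation by parts: add the sum to its image under the exchange, an involution of the window
that preserves the rate. -/
lemma two_mul_winSum_flux (hsymm : ∀ η, k (exch x η) = k η) (hx : x ∈ M) (hx' : x + 1 ∈ M)
    (g p : Config → ℝ) :
    2 * winSum M (fun η => k η * (g (exch x η) - g η) * p η) =
      winSum M fun η => k η * ((g (exch x η) - g η) * (p η - p (exch x η))) := by
  have h := winSum_exch hx hx' (fun η => k η * (g (exch x η) - g η) * p η)
  simp only [exch_exch, hsymm] at h
  rw [two_mul]
  nth_rewrite 2 [← h]
  rw [← winSum_add]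
  congr 1
  funext η
  ring

lemma two_mul_winSum_flux_le_interior (hk : ∀ η, 0 ≤ k η)
    (hsymm : ∀ η, k (exch x η) = k η) (hx : x ∈ L) (hx' : x + 1 ∈ L) (P : Config → ℝ)
    (hP : ∀ η, 0 ≤ P η) {ε : ℝ} (hε : 0 < ε) :
    2 * winSum L (fun η => k η * (Real.log (P (exch x η) + ε) - Real.log (P η + ε)) * P η) ≤
      - winSum L fun η => k η * (√(P η + ε) - √(P (exch x η) + ε)) ^ 2 := by
  rw [two_mul_winSum_flux hsymm hx hx' (fun η => Real.log (P η + ε)) P, winSum, winSum,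
    ← Finset.sum_neg_distrib]
  refine Finset.sum_le_sum fun η _ => ?_
  rw [← mul_neg]
  refine mul_le_mul_of_nonneg_left ?_ (hk η)
  have := log_sub_mul_sub_le (u := P η + ε) (v := P (exch x η) + ε)
    (by linarith [hP η]) (by linarith [hP (exch x η)])
  simpa using this

/-- Symmetrise, apply `log_sub_mul_sub_le_sqrt` pointwise, then Cauchy–Schwarz. The first factor is
the Dirichlet form on `M`; the two parts of the second factor are equal after an exchange. -/
lemma winSum_flux_le_boundary (hk : ∀ η, 0 ≤ k η)
    (hsymm : ∀ η, k (exch x η) = k η) (hx : x ∈ M) (hx' : x + 1 ∈ M) (P : Config → ℝ)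
    (hP : ∀ η, 0 < P η) (ν : Measure Config) :
    winSum M (fun η => k η * (Real.log (P (exch x η)) - Real.log (P η)) * marg ν M η) ≤
      4 * (√(bondForm ν k x M) *
        √(winSum M fun η => k η * (P (exch x η) / P η) * marg ν M η)) := by
  set p := marg ν M
  have hp : ∀ η, 0 ≤ p η := marg_nonneg ν M
  set w : Config → ℝ := fun η => √(p η) * √(P (exch x η) / P η) +
    √(p (exch x η)) * √(P η / P (exch x η)) with hw
  have hw2 : winSum M (fun η => k η * w η ^ 2) ≤
      4 * winSum M fun η => k η * (P (exch x η) / P η) * p η := by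
    have h1 : winSum M (fun η => k η * w η ^ 2) ≤ winSum M fun η =>
        2 * (k η * (P (exch x η) / P η) * p η +
          k (exch x η) * (P (exch x (exch x η)) / P (exch x η)) * p (exch x η)) := by
      refine winSum_mono fun η => ?_
      rw [hsymm, exch_exch]
      have h1 := Real.sq_sqrt (hp η)
      have h2 := Real.sq_sqrt (hp (exch x η))
      have h3 := Real.sq_sqrt (div_pos (hP (exch x η)) (hP η)).le
      have h4 := Real.sq_sqrt (div_pos (hP η) (hP (exch x η))).le
      have h5 : w η ^ 2 ≤ 2 * ((√(p η) * √(P (exch x η) / P η)) ^ 2 +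
          (√(p (exch x η)) * √(P η / P (exch x η))) ^ 2) := add_sq_le
      rw [mul_pow, mul_pow, h1, h2, h3, h4] at h5
      have := mul_le_mul_of_nonneg_left h5 (hk η)
      linarith
    rw [winSum_const_mul, winSum_add,
      winSum_exch hx hx' (fun η => k η * (P (exch x η) / P η) * p η)] at h1
    linarith
  have hcs : winSum M (fun η => k η * (|√(p η) - √(p (exch x η))| * w η)) ≤
      √(bondForm ν k x M) * √(winSum M (fun η => k η * w η ^ 2)) := by
    have := Real.sum_mul_le_sqrt_mul_sqrt (winConf M)
      (fun η => √(k η) * |√(p η) - √(p (exch x η))|) (fun η => √(k η) * w η)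
    convert this using 3
    · refine Finset.sum_congr rfl fun η _ => ?_
      rw [mul_mul_mul_comm, Real.mul_self_sqrt (hk η)]
    · refine Finset.sum_congr rfl fun η _ => ?_
      rw [mul_pow, Real.sq_sqrt (hk η), sq_abs]
    · refine Finset.sum_congr rfl fun η _ => ?_
      rw [mul_pow, Real.sq_sqrt (hk η)]
  have h2 : winSum M (fun η => k η * ((Real.log (P (exch x η)) - Real.log (P η)) *
      (p η - p (exch x η)))) ≤
      4 * winSum M (fun η => k η * (|√(p η) - √(p (exch x η))| * w η)) := by
    rw [← winSum_const_mul]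
    refine winSum_mono fun η => ?_
    have := mul_le_mul_of_nonneg_left
      (log_sub_mul_sub_le_sqrt (hp η) (hp (exch x η)) (hP η) (hP (exch x η))) (hk η)
    simp only [hw]
    linarith
  have h3 : √(winSum M (fun η => k η * w η ^ 2)) ≤
      2 * √(winSum M fun η => k η * (P (exch x η) / P η) * p η) := by
    refine (Real.sqrt_le_sqrt hw2).trans (le_of_eq ?_)
    rw [Real.sqrt_mul (by norm_num), show (4 : ℝ) = 2 ^ 2 by norm_num,
      Real.sqrt_sq (by norm_num)]
  have h4 := two_mul_winSum_flux hsymm hx hx' (fun η => Real.log (P η)) p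
  have h5 := mul_le_mul_of_nonneg_left h3 (Real.sqrt_nonneg (bondForm ν k x M))
  nlinarith

/-- The ratio at the exchanged configuration may depend on a site outside `L`, but it is at most one
plus the ratio at `τ η`, which is local to `L`. Against the marginal on `L` the denominator cancels,
and `τ` merely permutes the total mass. -/
lemma winSum_ratio_le (ν : Measure Config) [IsProbabilityMeasure ν] {K : ℝ} (hk : ∀ η, 0 ≤ k η)
    (hK : ∀ η, k η ≤ K) (hLM : L ⊆ M) {τ : Config → Config} (hτ : Function.Involutive τ)
    (hτL : ∀ η ∈ winConf L, τ η ∈ winConf L)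
    (hτdep : DependsOn (fun η => marg ν L (τ η)) (L : Set ℤ))
    (hcase : ∀ η, marg ν L (exch x η) = marg ν L η ∨ marg ν L (exch x η) = marg ν L (τ η))
    {ε : ℝ} (hε : 0 < ε) :
    winSum M (fun η => k η * ((marg ν L (exch x η) + ε) / (marg ν L η + ε)) * marg ν M η) ≤
      K * (2 + ε * (winConf L).card) := by
  set P := marg ν L
  have hPdep : DependsOn P (L : Set ℤ) := dependsOn_marg ν L
  have hP : ∀ η, 0 < P η + ε := fun η => by
    have : 0 ≤ P η := marg_nonneg ν L η
    linarith
  have hK0 : 0 ≤ K := (hk full).trans (hK full)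
  have hdep : DependsOn (fun η => (P (τ η) + ε) / (P η + ε)) (L : Set ℤ) := fun η ω h => by
    simp only; rw [hPdep h, show P (τ η) = P (τ ω) from hτdep h]
  have h1 : winSum M (fun η => k η * ((P (exch x η) + ε) / (P η + ε)) * marg ν M η) ≤
      winSum M fun η => K * (marg ν M η + (P (τ η) + ε) / (P η + ε) * marg ν M η) := by
    refine winSum_mono fun η => ?_
    have hb : (P (exch x η) + ε) / (P η + ε) ≤ 1 + (P (τ η) + ε) / (P η + ε) := by
      rcases hcase η with h | h <;> rw [h]
      · rw [div_self (hP η).ne']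
        linarith [div_pos (hP (τ η)) (hP η)]
      · linarith
    have h2 : k η * ((P (exch x η) + ε) / (P η + ε)) ≤
        K * (1 + (P (τ η) + ε) / (P η + ε)) :=
      mul_le_mul (hK η) hb (div_pos (hP _) (hP η)).le hK0
    have := mul_le_mul_of_nonneg_right h2 (marg_nonneg ν M η)
    linarith
  refine h1.trans ?_
  rw [winSum_const_mul, winSum_add, winSum_marg, winSum_marg_of_subset ν hLM hdep]
  refine mul_le_mul_of_nonneg_left ?_ hK0
  have h2 : winSum L (fun η => (P (τ η) + ε) / (P η + ε) * P η) ≤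
      winSum L fun η => P (τ η) + ε := by
    refine winSum_mono fun η => ?_
    have hPη : 0 ≤ P η := marg_nonneg ν L η
    rw [div_mul_eq_mul_div, div_le_iff₀ (hP η)]
    exact mul_le_mul_of_nonneg_left (by linarith) (hP (τ η)).le
  rw [winSum_add, winSum_comp_involution hτ hτL P, winSum_marg] at h2
  have h3 : winSum L (fun _ => ε) = ε * (winConf L).card := by simp [winSum, mul_comm]
  rw [h3] at h2
  change winSum L (fun η => (P (τ η) + ε) / (P η + ε) * P η) ≤ _ at h2
  linarith

end Entropy

end PorousMedium

namespace PorousMedium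

/-! ### Vanishing of the entropy production and reversibility. -/

section Reversibility

/-- The window `[-n, n]`. -/
noncomputable def win (n : ℕ) : Finset ℤ := Finset.Icc (-(n : ℤ)) n

lemma mem_win {n : ℕ} {x : ℤ} : x ∈ win n ↔ -(n : ℤ) ≤ x ∧ x ≤ n := Finset.mem_Icc

lemma win_mono {m n : ℕ} (h : m ≤ n) : win m ⊆ win n := fun x hx => by
  rw [mem_win] at hx ⊢; omega

lemma exists_subset_win (S : Finset ℤ) : ∃ n : ℕ, S ⊆ win n := by
  refine ⟨S.sup Int.natAbs, fun x hx => ?_⟩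
  have := Finset.le_sup (f := Int.natAbs) hx
  rw [mem_win]; omega

variable {c : ℤ → Config → ℝ}

namespace IsConstraint

lemma exists_range (hc : IsConstraint c) : ∃ r : ℕ, 1 ≤ r ∧
    ∀ x : ℤ, DependsOn (c x) (Finset.Icc (x - r) (x + r) : Finset ℤ) := by
  obtain ⟨S, hS⟩ := hc.isLocal
  obtain ⟨n, hn⟩ := exists_subset_win S
  refine ⟨n + 1, by omega, fun x η ω h => ?_⟩
  rw [hc.translation x η, hc.translation x ω]
  refine hS fun y hy => h _ ?_
  have := mem_win.1 (hn hy)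
  simp only [Finset.coe_Icc, Set.mem_Icc]
  push_cast
  omega

lemma exists_bound (hc : IsConstraint c) : ∃ K : ℝ, ∀ x η, c x η ≤ K := by
  obtain ⟨S, hS⟩ := hc.isLocal
  refine ⟨∑ η ∈ winConf S, c 0 η, fun x η => ?_⟩
  rw [hc.translation, ← DependsOn.trunc hS]
  exact Finset.single_le_sum (f := c 0) (fun ω _ => hc.nonneg 0 ω) (trunc_mem S _)

lemma exch_eq (hc : IsConstraint c) (x : ℤ) (η : Config) : c x (exch x η) = c x η := by
  rw [hc.translation x η, hc.translation x, hc.exch_symm]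
  congr 1
  funext y
  simp only [exch_apply, zero_add]
  congr 1
  rcases eq_or_ne y 0 with rfl | h0
  · simp
  rcases eq_or_ne y 1 with rfl | h1
  · simp
  rw [Equiv.swap_apply_of_ne_of_ne h0 h1, Equiv.swap_apply_of_ne_of_ne (by omega) (by omega)]

lemma pos_iff_occupied (hc : IsConstraint c) (x : ℤ) (η : Config) :
    0 < c x η ↔ η (x - 1) = true ∨ η (x + 2) = true := by
  rw [hc.translation, hc.pos_iff]
  simp only [occ, ← sub_eq_add_neg]
  cases η (x - 1) <;> cases η (x + 2) <;> simp

end IsConstraint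

lemma exch_eqOn_of_notMem {n : ℕ} {x : ℤ} (hx : x ∉ Finset.Icc (-(n : ℤ) - 1) n) (η : Config) :
    ∀ y ∈ (win n : Set ℤ), exch x η y = η y := by
  intro y hy
  have hy := mem_win.1 hy
  rw [Finset.mem_Icc] at hx
  exact exch_of_ne (by omega) (by omega) η

lemma generator_eq_sum (c : ℤ → Config → ℝ) {n : ℕ} {f : Config → ℝ}
    (hf : DependsOn f (win n : Set ℤ)) : generator c f = fun η =>
      ∑ x ∈ Finset.Icc (-(n : ℤ) - 1) n, c x η * (f (exch x η) - f η) := by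
  funext η
  refine finsum_eq_sum_of_support_subset _ fun x hx => ?_
  by_contra hx'
  refine hx ?_
  rw [Finset.mem_coe] at hx'
  simp only
  rw [hf (exch_eqOn_of_notMem hx' η), sub_self, mul_zero]

/-- An exchange at the edge of the window acts inside the window as the identity or as a flip. -/
lemma exists_window_involution (ν : Measure Config) {n : ℕ} {x : ℤ}
    (hx : x ∈ Finset.Icc (-(n : ℤ) - 1) n) :
    ∃ τ : Config → Config, Function.Involutive τ ∧ (∀ η ∈ winConf (win n), τ η ∈ winConf (win n)) ∧
      DependsOn (fun η => marg ν (win n) (τ η)) (win n : Set ℤ) ∧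
      ∀ η, marg ν (win n) (exch x η) = marg ν (win n) η ∨
        marg ν (win n) (exch x η) = marg ν (win n) (τ η) := by
  have hdep := dependsOn_marg ν (win n)
  rw [Finset.mem_Icc] at hx
  have hflip : ∀ y z : ℤ, (z = x ∧ y = x + 1 ∨ z = x + 1 ∧ y = x) → y ∉ win n → ∀ η,
      marg ν (win n) (exch x η) = marg ν (win n) η ∨
        marg ν (win n) (exch x η) = marg ν (win n) (flipAt z η) := by
    intro y z hyz hy η
    have hz : exch x η z = η y := by
      rcases hyz with ⟨rfl, rfl⟩ | ⟨rfl, rfl⟩ <;> simp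
    have hne : ∀ w ∈ win n, w ≠ z → exch x η w = η w := fun w hw hwz => by
      have : w ≠ y := fun h => hy (h ▸ hw)
      exact exch_of_ne (by omega) (by omega) η
    by_cases h : η y = η z
    · refine .inl (hdep fun w hw => ?_)
      by_cases hwz : w = z
      · rw [hwz, hz, h]
      · exact hne w hw hwz
    · refine .inr (hdep fun w hw => ?_)
      by_cases hwz : w = z
      · rw [hwz, hz, flipAt, Function.update_self]
        revert h; cases η y <;> cases η z <;> simp
      · rw [flipAt, Function.update_of_ne hwz]
        exact hne w hw hwz
  by_cases h1 : x ∈ win n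
  · by_cases h2 : x + 1 ∈ win n
    · exact ⟨exch x, exch_involutive x, exch_mem_winConf h1 h2, DependsOn.exch hdep h1 h2,
        fun η => .inr rfl⟩
    · exact ⟨flipAt x, flipAt_involutive x, flipAt_mem_winConf h1, DependsOn.flipAt hdep x,
        hflip (x + 1) x (.inl ⟨rfl, rfl⟩) h2⟩
  · have h2 : x + 1 ∈ win n := by rw [mem_win] at h1 ⊢; omega
    exact ⟨flipAt (x + 1), flipAt_involutive _, flipAt_mem_winConf h2, DependsOn.flipAt hdep _,
      hflip x (x + 1) (.inr ⟨rfl, rfl⟩) h1⟩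

/-- The bonds at the edge of the window `[-n, n]` whose rates, of range `r`, may depend on sites
outside. -/
noncomputable def edgeBonds (n r : ℕ) : Finset ℤ :=
  Finset.Icc (-(n : ℤ) - 1) n \ Finset.Icc (-(n : ℤ) + r) (n - r)

/-- The test function is `log (P + ε)` with `P` the marginal on `[-n, n]`. Its bond fluxes sum to
zero, so the dissipation inside is paid for by the flux through the edge bonds; then `ε` tends to
zero. -/
lemma sum_bondForm_interior_le (hc : IsConstraint c) {ν : Measure Config} (hν : IsStationary c ν)
    {r : ℕ} (hr : 1 ≤ r) (hdep : ∀ x : ℤ, DependsOn (c x) (Finset.Icc (x - r) (x + r) : Finset ℤ))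
    {K : ℝ} (hK : ∀ x η, c x η ≤ K) (n : ℕ) :
    ∑ x ∈ Finset.Icc (-(n : ℤ) + r) (n - r), bondForm ν (c x) x (win n) ≤
      8 * ∑ x ∈ edgeBonds n r, √(bondForm ν (c x) x (win (n + r + 1))) * √(K * 2) := by
  have := hν.1
  set L := win n
  -- Large enough to contain every bond meeting `[-n, n]` and all sites on which its rate depends.
  set M := win (n + r + 1)
  have hLM : L ⊆ M := win_mono (by omega)
  set P := marg ν L
  have hP : ∀ η, 0 ≤ P η := marg_nonneg ν L
  have hPdep : DependsOn P (L : Set ℤ) := dependsOn_marg ν L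
  have hbM : ∀ x ∈ Finset.Icc (-(n : ℤ) - 1) n, x ∈ M ∧ x + 1 ∈ M := by
    intro x hx
    rw [Finset.mem_Icc] at hx
    simp only [M, mem_win]
    push_cast
    omega
  have hint : Finset.Icc (-(n : ℤ) + r) (n - r) ⊆ Finset.Icc (-(n : ℤ) - 1) n := by
    intro x hx
    rw [Finset.mem_Icc] at hx ⊢
    omega
  have key : ∀ ε : ℝ, 0 < ε → ∑ x ∈ Finset.Icc (-(n : ℤ) + r) (n - r),
      winSum L (fun η => c x η * (√(P η + ε) - √(P (exch x η) + ε)) ^ 2) ≤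
      8 * ∑ x ∈ edgeBonds n r, √(bondForm ν (c x) x M) * √(K * (2 + ε * (winConf L).card)) := by
    intro ε hε
    set f : Config → ℝ := fun η => Real.log (P η + ε) with hf
    have hfdep : DependsOn f (L : Set ℤ) := fun η ω h => by simp only [f]; rw [hPdep h]
    have hgen := generator_eq_sum c hfdep
    have hterm : ∀ x ∈ Finset.Icc (-(n : ℤ) - 1) n,
        DependsOn (fun η => c x η * (f (exch x η) - f η)) (M : Set ℤ) := by
      intro x hx η ω h
      have h1 : c x η = c x ω := (hdep x).mono (by
        intro y hy
        rw [Finset.mem_Icc] at hx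
        simp only [Finset.coe_Icc, Set.mem_Icc] at hy
        simp only [M, Finset.mem_coe, mem_win]
        push_cast
        omega) h
      have hfM : DependsOn f (M : Set ℤ) := hfdep.mono (by exact_mod_cast hLM)
      have h2 : f (exch x η) = f (exch x ω) :=
        DependsOn.exch hfM (hbM x hx).1 (hbM x hx).2 h
      simp only
      rw [h1, h2, hfM h]
    set T : ℤ → ℝ := fun x => winSum M fun η => c x η * (f (exch x η) - f η) * marg ν M η with hT
    have hsum : ∑ x ∈ Finset.Icc (-(n : ℤ) - 1) n, T x = 0 := by
      rw [← hν.2 f ⟨L, hfdep⟩, hgen, integral_finsetSum]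
      · exact Finset.sum_congr rfl fun x hx => (integral_eq_winSum ν (hterm x hx)).symm
      · exact fun x hx => integrable_of_dependsOn ν (hterm x hx)
    have hin : ∀ x ∈ Finset.Icc (-(n : ℤ) + r) (n - r),
        2 * T x ≤ - winSum L (fun η => c x η * (√(P η + ε) - √(P (exch x η) + ε)) ^ 2) := by
      intro x hx
      rw [Finset.mem_Icc] at hx
      have hxL : x ∈ L := by simp only [L, mem_win]; omega
      have hxL' : x + 1 ∈ L := by simp only [L, mem_win]; omega
      have hcL : DependsOn (c x) (L : Set ℤ) := (hdep x).mono (by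
        intro y hy
        simp only [Finset.coe_Icc, Set.mem_Icc] at hy
        simp only [L, Finset.mem_coe, mem_win]
        omega)
      have hd : DependsOn (fun η => c x η * (f (exch x η) - f η)) (L : Set ℤ) := fun η ω h => by
        simp only
        rw [hcL h, hfdep h, show f (exch x η) = f (exch x ω) from DependsOn.exch hfdep hxL hxL' h]
      rw [hT]
      simp only
      rw [winSum_marg_of_subset ν hLM hd]
      exact two_mul_winSum_flux_le_interior (hc.nonneg x) (hc.exch_eq x) hxL hxL' P hP hε
    have hout : ∀ x ∈ edgeBonds n r,
        T x ≤ 4 * (√(bondForm ν (c x) x M) * √(K * (2 + ε * (winConf L).card))) := by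
      intro x hx
      have hx := (Finset.mem_sdiff.1 hx).1
      obtain ⟨τ, h1, h2, h3, h4⟩ := exists_window_involution ν hx
      have h5 := winSum_ratio_le ν (hc.nonneg x) (hK x) hLM h1 h2 h3 h4 hε
      refine (winSum_flux_le_boundary (hc.nonneg x) (hc.exch_eq x) (hbM x hx).1 (hbM x hx).2
        (fun η => P η + ε) (fun η => by linarith [hP η]) ν).trans ?_
      refine mul_le_mul_of_nonneg_left ?_ (by norm_num)
      exact mul_le_mul_of_nonneg_left (Real.sqrt_le_sqrt h5) (Real.sqrt_nonneg _)
    have hsplit := Finset.sum_sdiff hint (f := T)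
    rw [hsum] at hsplit
    have hin' := Finset.sum_le_sum hin
    rw [← Finset.mul_sum, Finset.sum_neg_distrib] at hin'
    have hout' := Finset.sum_le_sum hout
    rw [← Finset.mul_sum] at hout'
    change ∑ x ∈ edgeBonds n r, T x + _ = 0 at hsplit
    linarith
  have hc1 : Continuous fun ε : ℝ => ∑ x ∈ Finset.Icc (-(n : ℤ) + r) (n - r),
      winSum L (fun η => c x η * (√(P η + ε) - √(P (exch x η) + ε)) ^ 2) := by
    unfold winSum; fun_prop
  have hc2 : Continuous fun ε : ℝ => 8 * ∑ x ∈ edgeBonds n r,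
      √(bondForm ν (c x) x M) * √(K * (2 + ε * (winConf L).card)) := by fun_prop
  have hl1 := (hc1.tendsto 0).mono_left (nhdsWithin_le_nhds (s := Set.Ioi 0))
  have hl2 := (hc2.tendsto 0).mono_left (nhdsWithin_le_nhds (s := Set.Ioi 0))
  have := le_of_tendsto_of_tendsto hl1 hl2 (Filter.eventually_of_mem self_mem_nhdsWithin key)
  simpa [bondForm] using this

lemma sum_edgeBonds_le (n r : ℕ) (g : ℤ → ℝ) (hg : ∀ x, 0 ≤ g x) :
    ∑ x ∈ edgeBonds n r, g x ≤
      ∑ j ∈ Finset.range (r + 1), (g (-(n : ℤ) - 1 + j) + g (n - j)) := by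
  have hsub : edgeBonds n r ⊆ (Finset.range (r + 1)).image (fun j : ℕ => -(n : ℤ) - 1 + j) ∪
      (Finset.range (r + 1)).image (fun j : ℕ => (n : ℤ) - j) := by
    intro x hx
    simp only [edgeBonds, Finset.mem_sdiff, Finset.mem_Icc] at hx
    simp only [Finset.mem_union, Finset.mem_image, Finset.mem_range]
    by_cases h : x < -(n : ℤ) + r
    · exact .inl ⟨(x + n + 1).toNat, by omega, by omega⟩
    · exact .inr ⟨(n - x).toNat, by omega, by omega⟩
  refine (Finset.sum_le_sum_of_subset_of_nonneg hsub fun x _ _ => hg x).trans ?_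
  rw [Finset.sum_add_distrib]
  rw [← Finset.sum_image (f := g) (g := fun j : ℕ => -(n : ℤ) - 1 + j)
    (fun a _ b _ h => by simpa using h),
    ← Finset.sum_image (f := g) (g := fun j : ℕ => (n : ℤ) - j) (fun a _ b _ h => by simpa using h),
    ← Finset.sum_union_inter]
  have : 0 ≤ ∑ x ∈ (Finset.range (r + 1)).image (fun j : ℕ => -(n : ℤ) - 1 + j) ∩
      (Finset.range (r + 1)).image (fun j : ℕ => (n : ℤ) - j), g x :=
    Finset.sum_nonneg fun x _ => hg x
  linarith

open Filter Topology in
/-- The entropy production of a stationary measure vanishes at every bond. -/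
lemma bondForm_eq_zero (hc : IsConstraint c) {ν : Measure Config} (hν : IsStationary c ν)
    {r : ℕ} (hr : 1 ≤ r) (hdep : ∀ x : ℤ, DependsOn (c x) (Finset.Icc (x - r) (x + r) : Finset ℤ))
    (x : ℤ) (n : ℕ) (hn : x.natAbs + r + 1 ≤ n) : bondForm ν (c x) x (win n) = 0 := by
  have := hν.1
  obtain ⟨K, hK⟩ := hc.exists_bound
  have hK0 : 0 ≤ K := (hc.nonneg 0 full).trans (hK 0 full)
  have hmem : ∀ (x : ℤ) (m : ℕ), x.natAbs + r ≤ m → x ∈ win m ∧ x + 1 ∈ win m := by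
    intro x m h; simp only [mem_win]; omega
  have hmono : ∀ (x : ℤ) (m m' : ℕ), x.natAbs + r ≤ m → m ≤ m' →
      bondForm ν (c x) x (win m) ≤ bondForm ν (c x) x (win m') := by
    intro x m m' h h'
    refine bondForm_mono ν (hc.nonneg x) (hc.exch_eq x) ((hdep x).mono ?_) (win_mono h')
      (hmem x m h).1 (hmem x m h).2
    intro y hy
    simp only [Finset.coe_Icc, Set.mem_Icc] at hy
    simp only [Finset.mem_coe, mem_win]
    omega
  -- By monotonicity this supremum is the limit of the forms over growing windows; it is finite by
  -- `bondForm_le`.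
  let D : ℤ → ℝ := fun x => ⨆ j : ℕ, bondForm ν (c x) x (win (x.natAbs + r + j))
  have hbdd : ∀ x : ℤ, BddAbove (Set.range fun j : ℕ =>
      bondForm ν (c x) x (win (x.natAbs + r + j))) := by
    intro x
    refine ⟨K * 2, ?_⟩
    rintro _ ⟨j, rfl⟩
    exact bondForm_le ν (hc.nonneg x) (hK x) (hmem x _ (by omega)).1 (hmem x _ (by omega)).2
  have hleD : ∀ (x : ℤ) (m : ℕ), x.natAbs + r ≤ m → bondForm ν (c x) x (win m) ≤ D x := by
    intro x m h
    have := le_ciSup (hbdd x) (m - (x.natAbs + r))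
    simp only [Nat.add_sub_cancel' h] at this
    exact this
  have hD0 : ∀ x, 0 ≤ D x := fun x =>
    (bondForm_nonneg ν (hc.nonneg x)).trans (hleD x _ le_rfl)
  have hDK : ∀ x, D x ≤ K * 2 := fun x => ciSup_le fun j =>
    bondForm_le ν (hc.nonneg x) (hK x) (hmem x _ (by omega)).1 (hmem x _ (by omega)).2
  have hlim : ∀ x : ℤ, Tendsto (fun m : ℕ => bondForm ν (c x) x (win m)) atTop (𝓝 (D x)) := by
    intro x
    have h1 : Tendsto (fun j : ℕ => bondForm ν (c x) x (win (x.natAbs + r + j))) atTop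
        (𝓝 (D x)) :=
      tendsto_atTop_ciSup (fun a b hab => hmono x _ _ (by omega) (by omega)) (hbdd x)
    rw [← tendsto_add_atTop_iff_nat (x.natAbs + r)]
    simpa only [add_comm] using h1
  -- partial sums of `D` are controlled by the values of `D` at the edge of a large window
  let E : ℕ → ℝ := fun m => ∑ j ∈ Finset.range (r + 1),
    (√(D (-(m : ℤ) - 1 + j)) * √(K * 2) + √(D (m - j)) * √(K * 2))
  have hfin : ∀ (A : Finset ℤ), ∀ᶠ m : ℕ in atTop,
      ∑ x ∈ A, bondForm ν (c x) x (win m) ≤ 8 * E m := by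
    intro A
    obtain ⟨N, hN⟩ := exists_subset_win A
    filter_upwards [eventually_ge_atTop (N + r)] with m hm
    have hA : A ⊆ Finset.Icc (-(m : ℤ) + r) (m - r) := fun x hx => by
      have := mem_win.1 (hN hx)
      rw [Finset.mem_Icc]; omega
    calc _ ≤ ∑ x ∈ Finset.Icc (-(m : ℤ) + r) (m - r), bondForm ν (c x) x (win m) :=
          Finset.sum_le_sum_of_subset_of_nonneg hA
            fun x _ _ => bondForm_nonneg ν (hc.nonneg x)
      _ ≤ 8 * ∑ x ∈ edgeBonds m r, √(bondForm ν (c x) x (win (m + r + 1))) * √(K * 2) :=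
          sum_bondForm_interior_le hc hν hr hdep hK m
      _ ≤ 8 * ∑ x ∈ edgeBonds m r, √(D x) * √(K * 2) := by
          refine mul_le_mul_of_nonneg_left (Finset.sum_le_sum fun x hx => ?_) (by norm_num)
          refine mul_le_mul_of_nonneg_right (Real.sqrt_le_sqrt (hleD x _ ?_)) (Real.sqrt_nonneg _)
          simp only [edgeBonds, Finset.mem_sdiff, Finset.mem_Icc] at hx
          omega
      _ ≤ 8 * E m := by
          refine mul_le_mul_of_nonneg_left ?_ (by norm_num)
          exact sum_edgeBonds_le m r (fun x => √(D x) * √(K * 2)) fun x => by positivity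
  have hsumlim : ∀ A : Finset ℤ, Tendsto (fun m : ℕ => ∑ x ∈ A, bondForm ν (c x) x (win m)) atTop
      (𝓝 (∑ x ∈ A, D x)) := fun A => tendsto_finsetSum _ fun x _ => hlim x
  have hEbdd : ∀ m, E m ≤ ∑ j ∈ Finset.range (r + 1),
      (√(K * 2) * √(K * 2) + √(K * 2) * √(K * 2)) := by
    intro m
    refine Finset.sum_le_sum fun j _ => ?_
    gcongr <;> exact hDK _
  -- Dimension one enters here: `E m` has `2 * (r + 1)` terms whatever `m`, hence is bounded.
  -- Summability then forces `D` to vanish at infinity, which sends `E m` itself to zero.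
  have hsummable : Summable D := by
    refine summable_of_sum_le hD0 (c := 8 * ∑ j ∈ Finset.range (r + 1),
      (√(K * 2) * √(K * 2) + √(K * 2) * √(K * 2))) fun A => ?_
    refine le_of_tendsto (hsumlim A) ((hfin A).mono fun m hm => hm.trans ?_)
    exact mul_le_mul_of_nonneg_left (hEbdd m) (by norm_num)
  have hDlim : Tendsto D cofinite (𝓝 0) := hsummable.tendsto_cofinite_zero
  have hElim : Tendsto (fun m => 8 * E m) atTop (𝓝 0) := by
    have h0 : ∀ u : ℕ → ℤ, Function.Injective u →
        Tendsto (fun m => √(D (u m)) * √(K * 2)) atTop (𝓝 0) := by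
      intro u hu
      have h1 := hDlim.comp hu.tendsto_cofinite
      rw [Nat.cofinite_eq_atTop] at h1
      have h2 := ((Real.continuous_sqrt.tendsto 0).comp h1).mul_const (√(K * 2))
      simpa using h2
    have h1 : Tendsto E atTop (𝓝 (∑ j ∈ Finset.range (r + 1), (0 + 0))) :=
      tendsto_finsetSum _ fun j _ => (h0 (fun m => -(m : ℤ) - 1 + j) fun a b h => by
        simpa using h).add (h0 (fun m => (m : ℤ) - j) fun a b h => by simpa using h)
    simpa using h1.const_mul 8
  have hDx : D x ≤ 0 := by
    have := le_of_tendsto_of_tendsto (hsumlim {x}) hElim (hfin {x})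
    simpa using this
  exact le_antisymm ((hleD x n (by omega)).trans hDx) (bondForm_nonneg ν (hc.nonneg x))

/-- The configurations for which the exchange at the bond `{x, x + 1}` is allowed. -/
def allowed (x : ℤ) : Set Config := {η | η (x - 1) = true ∨ η (x + 2) = true}

lemma measurableSet_occupied (x : ℤ) : MeasurableSet {η : Config | η x = true} :=
  (measurable_pi_apply (X := fun _ : ℤ => Bool) x) (measurableSet_singleton true)

lemma measurableSet_allowed (x : ℤ) : MeasurableSet (allowed x) :=
  (measurableSet_occupied (x - 1)).union (measurableSet_occupied (x + 2))

lemma exch_mem_allowed {x : ℤ} {η : Config} : exch x η ∈ allowed x ↔ η ∈ allowed x := by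
  simp only [allowed, Set.mem_ofPred_eq]
  rw [exch_of_ne (by omega) (by omega), exch_of_ne (by omega) (by omega)]

/-- A measure for which every allowed exchange is reversible. -/
def IsReversible (ν : Measure Config) : Prop :=
  ∀ x : ℤ, ∀ A : Set Config, MeasurableSet A → A ⊆ allowed x → ν (exch x ⁻¹' A) = ν A

/-- Stationary measures are reversible. -/
theorem IsStationary.isReversible (hc : IsConstraint c) {ν : Measure Config}
    (hν : IsStationary c ν) : IsReversible ν := by
  classical
  have := hν.1
  intro x
  obtain ⟨r, hr, hdep⟩ := hc.exists_range
  have hres : (ν.restrict (allowed x)).map (exch x) = ν.restrict (allowed x) := by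
    refine (ext_of_ones fun I => ?_).symm
    rw [Measure.map_apply (measurable_exch x) (measurableSet_ones I),
      Measure.restrict_apply (measurableSet_ones I),
      Measure.restrict_apply (measurable_exch x (measurableSet_ones I))]
    have hmA : MeasurableSet (ones I ∩ allowed x) :=
      (measurableSet_ones I).inter (measurableSet_allowed x)
    have hpre : exch x ⁻¹' ones I ∩ allowed x = exch x ⁻¹' (ones I ∩ allowed x) := by
      ext η; simp [exch_mem_allowed]
    rw [hpre]
    obtain ⟨N, hN⟩ := exists_subset_win I
    set n := max N (x.natAbs + r + 2)
    have hxn : x ∈ win n ∧ x + 1 ∈ win n ∧ x - 1 ∈ win n ∧ x + 2 ∈ win n := by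
      simp only [mem_win]; omega
    let F : Config → ℝ := (ones I ∩ allowed x).indicator fun _ => 1
    have hF : DependsOn F (win n : Set ℤ) := by
      intro η ω h
      have h1 : η ∈ ones I ∩ allowed x ↔ ω ∈ ones I ∩ allowed x := by
        simp only [ones, allowed, Set.mem_inter_iff, Set.mem_ofPred_eq]
        rw [h _ hxn.2.2.1, h _ hxn.2.2.2]
        refine and_congr_left fun _ => forall₂_congr fun y hy => ?_
        rw [h y (win_mono (le_max_left _ _) (hN hy))]
      simp only [F, Set.indicator_apply, h1]
    have hzero := bondForm_eq_zero hc hν hr hdep x n (by omega)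
    rw [bondForm, winSum, Finset.sum_eq_zero_iff_of_nonneg
      fun η _ => mul_nonneg (hc.nonneg x η) (sq_nonneg _)] at hzero
    have hF' : DependsOn (fun η => F (exch x η)) (win n : Set ℤ) :=
      DependsOn.exch hF hxn.1 hxn.2.1
    have hI1 : ∫ η, F η ∂ν = ν.real (ones I ∩ allowed x) := by
      simp [F, integral_indicator_const _ hmA]
    have hI2 : ∫ η, F (exch x η) ∂ν = ν.real (exch x ⁻¹' (ones I ∩ allowed x)) := by
      have : (fun η => F (exch x η)) =
          (exch x ⁻¹' (ones I ∩ allowed x)).indicator fun _ => (1 : ℝ) := rfl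
      rw [this, integral_indicator_const _ (measurable_exch x hmA)]
      simp
    have : ν.real (ones I ∩ allowed x) = ν.real (exch x ⁻¹' (ones I ∩ allowed x)) := by
      rw [← hI1, ← hI2, integral_eq_winSum ν hF, integral_eq_winSum ν hF',
        ← winSum_exch hxn.1 hxn.2.1]
      refine Finset.sum_congr rfl fun η hη => ?_
      -- On allowed configurations the rate is positive, so the zero Dirichlet form equates the two
      -- marginals; elsewhere the test function vanishes.
      by_cases h : η ∈ allowed x
      · have h1 := (mul_eq_zero.1 (hzero η hη)).resolve_left
          ((hc.pos_iff_occupied x η).2 h).ne'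
        have h2 := sub_eq_zero.1 (pow_eq_zero_iff (two_ne_zero) |>.1 h1)
        rw [Real.sqrt_inj (marg_nonneg _ _ _) (marg_nonneg _ _ _)] at h2
        simp only [h2]
      · have : F (exch x η) = 0 := Set.indicator_of_notMem
          (fun h' => h (exch_mem_allowed.1 h'.2)) _
        simp only [this, zero_mul]
    rw [measureReal_def, measureReal_def,
      ENNReal.toReal_eq_toReal_iff' (measure_ne_top _ _) (measure_ne_top _ _)] at this
    exact this
  intro A hA hAx
  have h := congrArg (fun μ => μ A) hres
  simp only [Measure.map_apply (measurable_exch x) hA, Measure.restrict_apply hA,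
    Measure.restrict_apply (measurable_exch x hA)] at h
  rw [Set.inter_eq_left.2 hAx, Set.inter_eq_left.2] at h
  · exact h
  · exact fun η hη => exch_mem_allowed.1 (hAx hη)

end Reversibility

end PorousMedium

namespace PorousMedium

/-! ### Mobility of a pair of neighbouring particles. -/

section Pairs

/-- The configurations with particles at `x` and `x + 1`. -/
def pairAt (x : ℤ) : Set Config := {η | η x = true ∧ η (x + 1) = true}

lemma measurableSet_pairAt (x : ℤ) : MeasurableSet (pairAt x) :=
  (measurableSet_occupied x).inter (measurableSet_occupied (x + 1))

lemma exch_comm {x y : ℤ} (h : x + 2 ≤ y) (η : Config) :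
    exch x (exch y η) = exch y (exch x η) := by
  funext z
  by_cases h1 : z = x
  · subst h1
    rw [exch_left, exch_of_ne (by omega) (by omega), exch_of_ne (by omega) (by omega), exch_left]
  by_cases h2 : z = x + 1
  · subst h2
    rw [exch_right, exch_of_ne (by omega) (by omega), exch_of_ne (by omega) (by omega), exch_right]
  rw [exch_of_ne h1 h2]
  by_cases h3 : z = y
  · subst h3
    rw [exch_left, exch_left, exch_of_ne (by omega) (by omega)]
  by_cases h4 : z = y + 1
  · subst h4
    rw [exch_right, exch_right, exch_of_ne (by omega) (by omega)]
  rw [exch_of_ne h3 h4, exch_of_ne h3 h4, exch_of_ne h1 h2]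

variable {ν : Measure Config}

lemma rotate_right_subset {x : ℤ} {A : Set Config} (hAx : A ⊆ pairAt x) :
    exch x ⁻¹' (exch (x + 1) ⁻¹' A) ⊆ pairAt (x + 1) := by
  intro η hη
  have h := hAx hη
  simp only [pairAt, Set.mem_ofPred_eq, exch_left] at h
  rw [exch_of_ne (y := x) (by omega) (by omega), exch_left,
    exch_of_ne (y := x + 1 + 1) (by omega) (by omega)] at h
  exact h

/-- The two exchanges turn `h11` into `1h1` and then `11h`. In each, the particle of the triple
outside the exchanged bond makes the exchange allowed, whatever the value `h`. -/
lemma IsReversible.rotate_right (hν : IsReversible ν) {x : ℤ} {A : Set Config}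
    (hA : MeasurableSet A) (hAx : A ⊆ pairAt x) :
    ν (exch x ⁻¹' (exch (x + 1) ⁻¹' A)) = ν A := by
  rw [hν x _ (measurable_exch _ hA), hν (x + 1) A hA]
  · intro η hη
    exact .inl (by simpa using (hAx hη).1)
  · intro η hη
    have h := (hAx hη).2
    rw [exch_left, show x + 1 + 1 = x + 2 by ring] at h
    exact .inr h

lemma rotate_left_subset {x : ℤ} {A : Set Config} (hAx : A ⊆ pairAt x) :
    exch x ⁻¹' (exch (x - 1) ⁻¹' A) ⊆ pairAt (x - 1) := by
  intro η hη
  obtain ⟨h1, h2⟩ := hAx hη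
  have h3 := exch_right (x - 1) (exch x η)
  rw [sub_add_cancel] at h3
  rw [h3, exch_of_ne (by omega) (by omega)] at h1
  rw [exch_of_ne (by omega) (by omega), exch_right] at h2
  exact ⟨h1, by rwa [sub_add_cancel]⟩

lemma IsReversible.rotate_left (hν : IsReversible ν) {x : ℤ} {A : Set Config}
    (hA : MeasurableSet A) (hAx : A ⊆ pairAt x) :
    ν (exch x ⁻¹' (exch (x - 1) ⁻¹' A)) = ν A := by
  rw [hν x _ (measurable_exch _ hA), hν (x - 1) A hA]
  · intro η hη
    exact .inr (by rw [show x - 1 + 2 = x + 1 by ring]; exact (hAx hη).2)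
  · intro η hη
    have h1 := (hAx hη).1
    have h3 := exch_right (x - 1) η
    rw [sub_add_cancel] at h3
    exact .inl (h3 ▸ h1)

/-- On the event of a pair at `x`, every exchange to the right of the pair preserves `ν`. -/
lemma IsReversible.exch_right_of_pair (hν : IsReversible ν) (d : ℕ) : ∀ (x : ℤ) {A : Set Config},
    MeasurableSet A → A ⊆ pairAt x → ν (exch (x + 2 + d) ⁻¹' A) = ν A := by
  induction d with
  | zero =>
    intro x A hA hAx
    refine hν _ A hA fun η hη => .inl ?_
    rw [show x + 2 + ((0 : ℕ) : ℤ) - 1 = x + 1 by push_cast; ring]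
    exact (hAx hη).2
  | succ d ih =>
    intro x A hA hAx
    set y := x + 2 + ((d + 1 : ℕ) : ℤ) with hy
    push_cast at hy
    -- Conjugation: move the pair one step towards the bond at `y`, exchange there by induction, and
    -- move it back. The rotation touches only `x`, `x + 1`, `x + 2`, so it commutes with the
    -- exchange at `y`.
    have h1 := ih (x + 1) (measurable_exch _ (measurable_exch _ hA)) (rotate_right_subset hAx)
    rw [show x + 1 + 2 + (d : ℤ) = y by rw [hy]; ring, hν.rotate_right hA hAx] at h1
    rw [← h1, ← hν.rotate_right (measurable_exch y hA)]
    · congr 1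
      ext η
      simp only [Set.mem_preimage]
      rw [← exch_comm (x := x + 1) (y := y) (by omega), ← exch_comm (x := x) (y := y) (by omega)]
    · intro η hη
      have := hAx hη
      simp only [pairAt, Set.mem_ofPred_eq] at this ⊢
      rwa [exch_of_ne (by omega) (by omega), exch_of_ne (by omega) (by omega)] at this

/-- On the event of a pair at `x`, every exchange to the left of the pair preserves `ν`. -/
lemma IsReversible.exch_left_of_pair (hν : IsReversible ν) (d : ℕ) : ∀ (x : ℤ) {A : Set Config},
    MeasurableSet A → A ⊆ pairAt x → ν (exch (x - 2 - d) ⁻¹' A) = ν A := by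
  induction d with
  | zero =>
    intro x A hA hAx
    refine hν _ A hA fun η hη => .inr ?_
    rw [show x - 2 - ((0 : ℕ) : ℤ) + 2 = x by push_cast; ring]
    exact (hAx hη).1
  | succ d ih =>
    intro x A hA hAx
    set y := x - 2 - ((d + 1 : ℕ) : ℤ) with hy
    push_cast at hy
    have h1 := ih (x - 1) (measurable_exch _ (measurable_exch _ hA)) (rotate_left_subset hAx)
    rw [show x - 1 - 2 - (d : ℤ) = y by rw [hy]; ring, hν.rotate_left hA hAx] at h1
    rw [← h1, ← hν.rotate_left (measurable_exch y hA)]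
    · congr 1
      ext η
      simp only [Set.mem_preimage]
      rw [exch_comm (x := y) (y := x - 1) (by omega), exch_comm (x := y) (y := x) (by omega)]
    · intro η hη
      have := hAx hη
      simp only [pairAt, Set.mem_ofPred_eq] at this ⊢
      rwa [exch_of_ne (by omega) (by omega), exch_of_ne (by omega) (by omega)] at this

end Pairs

/-! ### From adjacent transpositions to exchangeability; Bernoulli sequences. -/

section Exchangeability

lemma eq_range_of_forall_succ {I : Finset ℕ} (h : ∀ n, n + 1 ∈ I → n ∈ I) :
    I = Finset.range I.card := by
  have h1 : ∀ a, a ∈ I → ∀ b ≤ a, b ∈ I := by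
    intro a ha b hb
    induction hb using Nat.decreasingInduction with
    | of_succ k _ ih => exact h k ih
    | self => exact ha
  refine Finset.eq_of_subset_of_card_le (fun a ha => ?_) (by simp)
  have : Finset.range (a + 1) ⊆ I := fun b hb => h1 a ha b (by simpa [Nat.lt_succ_iff] using hb)
  have := Finset.card_le_card this
  rw [Finset.card_range] at this
  exact Finset.mem_range.2 this

/-- A function of finite sets of naturals that is invariant under adjacent transpositions depends
only on the cardinality. -/
lemma eq_of_invariant_adjacent {α : Type*} {f : Finset ℕ → α}
    (h : ∀ n I, f (I.map (Equiv.swap n (n + 1)).toEmbedding) = f I) (I : Finset ℕ) :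
    f I = f (Finset.range I.card) := by
  -- Moving an element from `n + 1` to a vacant `n` lowers the sum of the elements; sets admitting
  -- no such move are initial segments.
  induction hs : ∑ i ∈ I, i using Nat.strong_induction_on generalizing I with
  | _ s ih =>
    by_cases hI : ∀ n, n + 1 ∈ I → n ∈ I
    · rw [← eq_range_of_forall_succ hI]
    · push Not at hI
      obtain ⟨n, hn1, hn⟩ := hI
      have hmap : ∑ i ∈ I.map (Equiv.swap n (n + 1)).toEmbedding, i < s := by
        rw [Finset.sum_map, ← hs]
        refine Finset.sum_lt_sum (fun i hi => ?_) ⟨n + 1, hn1, by simp⟩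
        simp only [Equiv.coe_toEmbedding]
        by_cases h1 : i = n + 1
        · subst h1; simp
        · rw [Equiv.swap_apply_of_ne_of_ne (by rintro rfl; exact hn hi) h1]
      rw [← h n I, ih _ hmap _ rfl, Finset.card_map]

/-- The embedding `n ↦ m + n` of the naturals as a half-line. -/
def halfLine (m : ℤ) : ℕ ↪ ℤ := ⟨fun n => m + n, fun a b h => by simpa using h⟩

@[simp] lemma halfLine_apply (m : ℤ) (n : ℕ) : halfLine m n = m + n := rfl

/-- The restriction of a configuration to the half-line `[m, ∞)`. -/
def restrictHalfLine (m : ℤ) (η : Config) : ℕ → Bool := fun n => η (m + n)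

lemma measurable_restrictHalfLine (m : ℤ) : Measurable (restrictHalfLine m) :=
  measurable_pi_lambda _ fun _ => measurable_pi_apply _

lemma restrictHalfLine_preimage_ones (m : ℤ) (I : Finset ℕ) :
    restrictHalfLine m ⁻¹' ones I = ones (I.map (halfLine m)) := by
  ext η; simp [ones, restrictHalfLine]

lemma map_swap_halfLine (m : ℤ) (n : ℕ) (I : Finset ℕ) :
    (I.map (Equiv.swap n (n + 1)).toEmbedding).map (halfLine m) =
      (I.map (halfLine m)).map (Equiv.swap (m + n) (m + n + 1)).toEmbedding := by
  rw [Finset.map_map, Finset.map_map]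
  congr 1
  ext i
  simp only [Function.Embedding.trans_apply, Equiv.coe_toEmbedding, halfLine_apply]
  by_cases h1 : i = n
  · subst h1; simp [add_assoc]
  by_cases h2 : i = n + 1
  · subst h2
    rw [Equiv.swap_apply_right, show m + ((n + 1 : ℕ) : ℤ) = m + n + 1 by push_cast; ring,
      Equiv.swap_apply_right]
  rw [Equiv.swap_apply_of_ne_of_ne h1 h2, Equiv.swap_apply_of_ne_of_ne (by omega) (by omega)]

lemma exch_preimage_ones (y : ℤ) (I : Finset ℤ) :
    exch y ⁻¹' ones I = ones (I.map (Equiv.swap y (y + 1)).toEmbedding) := by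
  ext η
  simp only [ones, Set.mem_preimage, Set.mem_ofPred_eq, Finset.forall_mem_map]
  rfl

lemma exists_eq_map_halfLine (I : Finset ℤ) (m : ℤ) (h : ∀ i ∈ I, m ≤ i) :
    ∃ I' : Finset ℕ, I = I'.map (halfLine m) := by
  refine ⟨I.image fun i => (i - m).toNat, ?_⟩
  ext i
  simp only [Finset.mem_map, Finset.mem_image, halfLine_apply]
  constructor
  · intro hi
    exact ⟨_, ⟨i, hi, rfl⟩, by have := h i hi; omega⟩
  · rintro ⟨_, ⟨j, hj, rfl⟩, rfl⟩
    have := h j hj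
    rwa [Int.toNat_of_nonneg (by omega), add_sub_cancel]

/-- A measure invariant under all exchanges is exchangeable. -/
lemma measure_ones_eq_of_exch {μ : Measure Config} (h : ∀ y, μ.map (exch y) = μ)
    {I J : Finset ℤ} (hIJ : I.card = J.card) : μ (ones I) = μ (ones J) := by
  obtain ⟨N, hN⟩ := exists_subset_win (I ∪ J)
  have hm : ∀ i ∈ I ∪ J, -(N : ℤ) ≤ i := fun i hi => (mem_win.1 (hN hi)).1
  obtain ⟨I', rfl⟩ := exists_eq_map_halfLine I (-N) fun i hi => hm i (Finset.mem_union_left _ hi)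
  obtain ⟨J', rfl⟩ := exists_eq_map_halfLine J (-N) fun i hi => hm i (Finset.mem_union_right _ hi)
  have hinv : ∀ (n : ℕ) (K : Finset ℕ),
      μ (ones ((K.map (Equiv.swap n (n + 1)).toEmbedding).map (halfLine (-N)))) =
        μ (ones (K.map (halfLine (-N)))) := by
    intro n K
    rw [map_swap_halfLine, ← exch_preimage_ones, ← Measure.map_apply (measurable_exch _)
      (measurableSet_ones _), h]
  have := eq_of_invariant_adjacent (f := fun K => μ (ones (K.map (halfLine (-N))))) hinv
  rw [Finset.card_map, Finset.card_map] at hIJ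
  have h1 := this I'
  have h2 := this J'
  rw [h1, h2, hIJ]

lemma bernoulliPi_map_exch (ρ : unitInterval) (y : ℤ) :
    (bernoulliPi ℤ ρ).map (exch y) = bernoulliPi ℤ ρ := by
  have := Measure.isProbabilityMeasure_map (μ := bernoulliPi ℤ ρ) (measurable_exch y).aemeasurable
  refine ext_of_ones fun I => ?_
  rw [Measure.map_apply (measurable_exch y) (measurableSet_ones I), exch_preimage_ones,
    bernoulliPi_ones, bernoulliPi_ones, Finset.card_map]

lemma bernoulliPi_map_restrictHalfLine (ρ : unitInterval) (m : ℤ) :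
    (bernoulliPi ℤ ρ).map (restrictHalfLine m) = bernoulliPi ℕ ρ := by
  have := Measure.isProbabilityMeasure_map (μ := bernoulliPi ℤ ρ)
    (measurable_restrictHalfLine m).aemeasurable
  refine ext_of_ones fun I => ?_
  rw [Measure.map_apply (measurable_restrictHalfLine m) (measurableSet_ones I),
    restrictHalfLine_preimage_ones, bernoulliPi_ones, bernoulliPi_ones, Finset.card_map]

lemma bernoulliPi_zero (ι : Type*) : bernoulliPi ι 0 = Measure.dirac fun _ => false := by
  simp [bernoulliPi]

lemma bernoulliPi_one (ι : Type*) : bernoulliPi ι 1 = Measure.dirac fun _ => true := by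
  simp [bernoulliPi]

/-- The sequences with infinitely many pairs of neighbouring particles. -/
def infPairs : Set (ℕ → Bool) := {η | ∀ m : ℕ, ∃ n ≥ m, η n = true ∧ η (n + 1) = true}

lemma measurableSet_infPairs : MeasurableSet infPairs := by
  have : infPairs = ⋂ m : ℕ, ⋃ n ≥ m, ones {n, n + 1} := by
    
    ext η
    simp only [infPairs, ones, Set.mem_iInter, Set.mem_iUnion, Set.mem_ofPred_eq,
      Finset.mem_insert, Finset.mem_singleton, forall_eq_or_imp, forall_eq, exists_prop]
  rw [this]
  exact MeasurableSet.iInter fun m => MeasurableSet.iUnion fun n => MeasurableSet.iUnion fun _ =>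
    measurableSet_ones _

/-- Bernoulli sequences of positive density have infinitely many pairs. -/
lemma bernoulliPi_infPairs {ρ : unitInterval} (hρ : ρ ≠ 0) : bernoulliPi ℕ ρ infPairs = 1 := by
  classical
  have hρ' : ENNReal.ofReal ρ ≠ 0 := by
    have : (0 : ℝ) < ρ := lt_of_le_of_ne ρ.2.1 fun h => hρ (Subtype.ext h.symm)
    simpa using this
  -- Disjoint blocks make these events independent, each of probability `ρ ^ 2`, so the second
  -- Borel–Cantelli lemma applies.
  let s : ℕ → Set (ℕ → Bool) := fun j => ones {2 * j, 2 * j + 1}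
  have hs : ∀ j, bernoulliPi ℕ ρ (s j) = ENNReal.ofReal ρ ^ 2 := fun j => by
    rw [bernoulliPi_ones, Finset.card_pair (by omega)]
  have hind : iIndepSet s (bernoulliPi ℕ ρ) := by
    rw [iIndepSet_iff_meas_biInter fun j => measurableSet_ones _]
    intro t
    have h1 : ⋂ j ∈ t, s j = ones (t.biUnion fun j => {2 * j, 2 * j + 1}) := by
      ext η
      simp only [s, ones, Set.mem_iInter, Set.mem_ofPred_eq, Finset.mem_biUnion]
      exact ⟨fun h i ⟨j, hj, hi⟩ => h j hj i hi, fun h j hj i hi => h i ⟨j, hj, hi⟩⟩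
    rw [h1, bernoulliPi_ones, Finset.card_biUnion, Finset.prod_congr rfl fun j _ => hs j,
      Finset.prod_const, ← pow_mul]
    · congr 1
      rw [Finset.sum_congr rfl fun j _ => Finset.card_pair (by omega : 2 * j ≠ 2 * j + 1)]
      simp [mul_comm]
    · intro i _ j _ hij
      rw [Function.onFun, Finset.disjoint_left]
      intro a ha hb
      simp only [Finset.mem_insert, Finset.mem_singleton] at ha hb
      omega
  have hlim := measure_limsup_eq_one (s := s) (fun j => measurableSet_ones _) hind (by
    simp only [hs]
    exact ENNReal.tsum_const_eq_top_of_ne_zero (pow_ne_zero 2 hρ'))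
  refine le_antisymm prob_le_one ?_
  rw [← hlim]
  refine measure_mono fun η hη m => ?_
  rw [Filter.mem_limsup_iff_frequently_mem, Filter.frequently_atTop] at hη
  obtain ⟨j, hj, h⟩ := hη m
  exact ⟨2 * j, by omega, h _ (by simp), h _ (by simp)⟩

lemma measurableSet_exists_occupied : MeasurableSet {η : ℕ → Bool | ∃ n, η n = true} := by
  have : {η : ℕ → Bool | ∃ n, η n = true} = ⋃ n, ones {n} := by ext η; simp [ones]
  rw [this]
  exact MeasurableSet.iUnion fun n => measurableSet_ones _

lemma bernoulliPi_occupied_diff_infPairs (ρ : unitInterval) :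
    bernoulliPi ℕ ρ ({η | ∃ n, η n = true} \ infPairs) = 0 := by
  rcases eq_or_ne ρ 0 with rfl | hρ
  · refine measure_mono_null Set.sdiff_subset ?_
    rw [bernoulliPi_zero, Measure.dirac_apply' _ measurableSet_exists_occupied]
    simp
  · refine measure_mono_null (t := infPairsᶜ) (fun η hη => hη.2) ?_
    rw [prob_compl_eq_zero_iff measurableSet_infPairs]
    exact bernoulliPi_infPairs hρ

end Exchangeability

/-! ### Non-frozen configurations have pairs arbitrarily far to the right. -/

section ManyPairs

variable {ν : Measure Config}

/-- The configurations with pairs of neighbouring particles arbitrarily far to the right. -/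
def manyPairs : Set Config := {η | ∀ m : ℤ, ∃ x ≥ m, η ∈ pairAt x}

lemma measurableSet_manyPairs : MeasurableSet manyPairs := by
  have : manyPairs = ⋂ m : ℤ, ⋃ x ≥ m, pairAt x := by ext η; simp [manyPairs]
  rw [this]
  exact MeasurableSet.iInter fun m => MeasurableSet.iUnion fun x => MeasurableSet.iUnion fun _ =>
    measurableSet_pairAt _

lemma exch_mem_manyPairs {y : ℤ} {η : Config} : exch y η ∈ manyPairs ↔ η ∈ manyPairs := by
  have key : ∀ η : Config, η ∈ manyPairs → exch y η ∈ manyPairs := by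
    intro η h m
    obtain ⟨x, hx, h1, h2⟩ := h (max m (y + 2))
    exact ⟨x, by omega, by rwa [exch_of_ne (by omega) (by omega)],
      by rwa [exch_of_ne (by omega) (by omega)]⟩
  exact ⟨fun h => by simpa using key _ h, key η⟩

lemma restrictHalfLine_mem_infPairs {m : ℤ} {η : Config} (h : restrictHalfLine m η ∈ infPairs) :
    η ∈ manyPairs := by
  intro l
  obtain ⟨n, hn, h1, h2⟩ := h (l - m).toNat
  refine ⟨m + n, by omega, h1, ?_⟩
  simp only [restrictHalfLine, Nat.cast_add, Nat.cast_one, ← add_assoc] at h2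
  exact h2

/-- A pair at `x` with nothing to its right. -/
def lastPair (x : ℤ) : Set Config := {η | η ∈ pairAt x ∧ ∀ y ≥ x + 2, η y = false}

lemma measurableSet_lastPair (x : ℤ) : MeasurableSet (lastPair x) := by
  have : lastPair x = pairAt x ∩ ⋂ y ≥ x + 2, {η : Config | η y = true}ᶜ := by
    ext η; simp [lastPair]
  rw [this]
  exact (measurableSet_pairAt x).inter (MeasurableSet.iInter fun y => MeasurableSet.iInter fun _ =>
    (measurableSet_occupied y).compl)

lemma IsReversible.measure_lastPair_le (hν : IsReversible ν) (x : ℤ) :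
    ν (lastPair x) ≤ ν (lastPair (x + 1)) := by
  have hsub : lastPair x ⊆ pairAt x := fun η h => h.1
  rw [← hν.rotate_right (measurableSet_lastPair x) hsub]
  refine measure_mono fun η hη => ⟨rotate_right_subset hsub hη, fun y hy => ?_⟩
  have := hη.2 y (by omega)
  rwa [exch_of_ne (by omega) (by omega), exch_of_ne (by omega) (by omega)] at this

/-- The position of the last pair is unique, so these events are disjoint in `x`, while their masses
do not decrease as the pair moves right. A positive mass would give infinite total mass. -/
lemma IsReversible.measure_lastPair (hν : IsReversible ν) [IsFiniteMeasure ν] (x : ℤ) :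
    ν (lastPair x) = 0 := by
  have hle : ∀ j : ℕ, ν (lastPair x) ≤ ν (lastPair (x + j)) := by
    intro j
    induction j with
    | zero => simp
    | succ j ih =>
      refine ih.trans ?_
      push_cast
      rw [← add_assoc]
      exact hν.measure_lastPair_le _
  have hdisj : Pairwise (Function.onFun Disjoint fun j : ℕ => lastPair (x + j)) := by
    have key : ∀ i j : ℕ, i < j → Disjoint (lastPair (x + i)) (lastPair (x + j)) := by
      intro i j hij
      rw [Set.disjoint_left]
      intro η h1 h2
      have h3 := h1.2 (x + j + 1) (by omega)
      rw [h2.1.2] at h3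
      exact absurd h3 (by simp)
    intro i j hij
    rcases lt_or_gt_of_ne hij with h | h
    · exact key i j h
    · exact (key j i h).symm
  by_contra hne
  have h1 : ∑' j : ℕ, ν (lastPair (x + j)) = ∞ := by
    refine top_le_iff.1 ?_
    rw [← ENNReal.tsum_const_eq_top_of_ne_zero (α := ℕ) hne]
    exact ENNReal.tsum_le_tsum hle
  rw [← measure_iUnion hdisj fun j => measurableSet_lastPair _] at h1
  exact measure_ne_top _ _ h1

/-- On the event of a pair at `x`, the configuration on `[x + 2, ∞)` is exchangeable. As a Bernoulli
mixture it is almost surely empty or has infinitely many pairs, and emptiness means that the pair at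
`x` is the last one. -/
lemma IsReversible.measure_pairAt_diff (hν : IsReversible ν) [IsFiniteMeasure ν] (x : ℤ) :
    ν (pairAt x \ manyPairs) = 0 := by
  set μ := (ν.restrict (pairAt x)).map (restrictHalfLine (x + 2))
  have hmeas := measurable_restrictHalfLine (x + 2)
  have hμ : ∀ I : Finset ℕ, μ (ones I) = ν (ones (I.map (halfLine (x + 2))) ∩ pairAt x) := by
    intro I
    rw [Measure.map_apply hmeas (measurableSet_ones I), restrictHalfLine_preimage_ones,
      Measure.restrict_apply (measurableSet_ones _)]
  have hinv : ∀ (n : ℕ) (I : Finset ℕ),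
      μ (ones (I.map (Equiv.swap n (n + 1)).toEmbedding)) = μ (ones I) := by
    intro n I
    rw [hμ, hμ, map_swap_halfLine, ← exch_preimage_ones]
    rw [← hν.exch_right_of_pair n x (((measurableSet_ones _)).inter (measurableSet_pairAt x))
      Set.inter_subset_right]
    congr 1
    ext η
    simp only [Set.mem_inter_iff, Set.mem_preimage, pairAt, Set.mem_ofPred_eq]
    rw [exch_of_ne (y := x) (by omega) (by omega), exch_of_ne (y := x + 1) (by omega) (by omega)]
  obtain ⟨lam, -, hlam⟩ := exists_mixture_of_exchangeable μ (fun I J hIJ => by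
    have h := eq_of_invariant_adjacent (f := fun I => μ (ones I)) hinv
    rw [h I, h J, hIJ])
  have hH := measurableSet_exists_occupied.diff measurableSet_infPairs
  have h0 : μ ({η | ∃ n, η n = true} \ infPairs) = 0 := by
    rw [hlam _ hH]
    simp [bernoulliPi_occupied_diff_infPairs]
  rw [Measure.map_apply hmeas hH, Measure.restrict_apply (hmeas hH)] at h0
  refine measure_mono_null (fun η hη => ?_) (measure_union_null h0 (hν.measure_lastPair x))
  by_cases h : ∃ n, restrictHalfLine (x + 2) η n = true
  · exact .inl ⟨⟨h, fun h' => hη.2 (restrictHalfLine_mem_infPairs h')⟩, hη.1⟩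
  · refine .inr ⟨hη.1, fun y hy => ?_⟩
    push Not at h
    have := h (y - (x + 2)).toNat
    rw [restrictHalfLine, Int.toNat_of_nonneg (by omega), add_sub_cancel] at this
    simpa using this

/-- Almost every non-frozen configuration has pairs arbitrarily far to the right. -/
lemma IsReversible.measure_compl_frozen_diff (hν : IsReversible ν) [IsFiniteMeasure ν] :
    ν (frozenᶜ \ manyPairs) = 0 := by
  have hsub : frozenᶜ \ manyPairs ⊆ ⋃ x : ℤ, ((pairAt x \ manyPairs) ∪
      exch (x + 1) ⁻¹' (pairAt x \ manyPairs)) := by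
    rintro η ⟨hη, hηG⟩
    simp only [frozen, Set.mem_compl_iff, Set.mem_ofPred_eq, not_forall] at hη
    obtain ⟨x, hx, hne⟩ := hη
    have hx' : η x = true := by
      revert hx; unfold occ; cases η x <;> simp
    refine Set.mem_iUnion.2 ⟨x, ?_⟩
    -- Otherwise the pattern at `x` is `101`, and the exchange at `x + 1`, allowed by the particle
    -- at `x`, produces a pair.
    by_cases h1 : η (x + 1) = true
    · exact .inl ⟨⟨hx', h1⟩, hηG⟩
    · have h2 : η (x + 2) = true := by
        revert h1 hne; unfold occ; cases η (x + 1) <;> cases η (x + 2) <;> simp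
      refine .inr ⟨⟨?_, ?_⟩, fun h => hηG (exch_mem_manyPairs.1 h)⟩
      · rwa [exch_of_ne (by omega) (by omega)]
      · rwa [exch_left, show x + 1 + 1 = x + 2 by ring]
  refine measure_mono_null hsub (measure_iUnion_null fun x => measure_union_null
    (hν.measure_pairAt_diff x) ?_)
  rw [hν (x + 1) _ ((measurableSet_pairAt x).diff measurableSet_manyPairs)]
  · exact hν.measure_pairAt_diff x
  · intro η hη
    exact .inl (by simpa using hη.1.1)

/-- On the configurations with many pairs, all exchanges preserve `ν`. -/
lemma IsReversible.measure_exch_preimage (hν : IsReversible ν) (y : ℤ) {A : Set Config}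
    (hA : MeasurableSet A) (hAG : A ⊆ manyPairs) : ν (exch y ⁻¹' A) = ν A := by
  -- Partition by the first pair to the right of the bond at `y`; on each piece `exch_left_of_pair`
  -- applies at the matching distance.
  let S : ℕ → Set Config := disjointed fun j : ℕ => pairAt (y + 2 + j)
  have hS : ∀ j, MeasurableSet (S j) := fun j =>
    MeasurableSet.disjointed (fun i => measurableSet_pairAt _) j
  have hSd : Pairwise (Function.onFun Disjoint S) := disjoint_disjointed _
  have hAS : A = ⋃ j, A ∩ S j := by
    rw [← Set.inter_iUnion, iUnion_disjointed, eq_comm, Set.inter_eq_left]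
    intro η hη
    obtain ⟨x, hx, h⟩ := hAG hη (y + 2)
    refine Set.mem_iUnion.2 ⟨(x - (y + 2)).toNat, ?_⟩
    rwa [Int.toNat_of_nonneg (by omega), add_sub_cancel]
  have hd : Pairwise (Function.onFun Disjoint fun j => A ∩ S j) := fun i j hij =>
    (hSd hij).mono Set.inter_subset_right Set.inter_subset_right
  have hpre : exch y ⁻¹' A = ⋃ j, exch y ⁻¹' (A ∩ S j) := by
    rw [← Set.preimage_iUnion, ← hAS]
  rw [hpre]
  conv_rhs => rw [hAS]
  rw [measure_iUnion (fun i j hij => (hd hij).preimage _)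
    fun j => measurable_exch y (hA.inter (hS j)), measure_iUnion hd fun j => hA.inter (hS j)]
  refine tsum_congr fun j => ?_
  have := hν.exch_left_of_pair j (y + 2 + j) (hA.inter (hS j))
    (Set.inter_subset_right.trans (disjointed_subset _ j))
  rwa [show y + 2 + (j : ℤ) - 2 - j = y by ring] at this

end ManyPairs

end PorousMedium

namespace PorousMedium

/-! ### The exceptional classes and the decomposition of `ν`. -/

section Decomposition

variable {ν : Measure Config} {c : ℤ → Config → ℝ}

lemma occ_eq_one_iff {η : Config} {x : ℤ} : occ η x = 1 ↔ η x = true := by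
  unfold occ; cases η x <;> simp

lemma measurable_occ (x : ℤ) : Measurable fun η : Config => occ η x :=
  (measurable_of_countable Bool.toNat).comp (measurable_pi_apply x)

lemma measurableSet_frozen : MeasurableSet frozen := by
  have : frozen = ⋂ x : ℤ, {η : Config | occ η x = 1}ᶜ ∪
      {η : Config | occ η (x + 1) + occ η (x + 2) = 0} := by
    ext η; simp [frozen, imp_iff_not_or]
  rw [this]
  exact MeasurableSet.iInter fun x =>
    ((measurable_occ x) (measurableSet_singleton 1)).compl.union
      (((measurable_occ _).add (measurable_occ _)) (measurableSet_singleton 0))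

lemma infinite_pairs {η : Config} (h : η ∈ manyPairs) : {x : ℤ | η ∈ pairAt x}.Infinite := by
  intro hfin
  obtain ⟨m, hm⟩ := hfin.bddAbove
  obtain ⟨x, hx, hp⟩ := h (m + 1)
  have := hm hp
  omega

lemma tsum_eq_top_of_infinite {f : ℤ → ℕ} (h : {x | 1 ≤ f x}.Infinite) :
    ∑' x, (f x : ℝ≥0∞) = ∞ := by
  by_contra hne
  refine h ((ENNReal.finite_const_le_of_tsum_ne_top hne one_ne_zero).subset fun x hx => ?_)
  simp only [Set.mem_ofPred_eq] at hx ⊢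
  exact_mod_cast hx

lemma notMem_frozen_of_manyPairs {η : Config} (h : η ∈ manyPairs) : η ∉ frozen := by
  intro hf
  obtain ⟨x, -, h1, h2⟩ := h 0
  have h3 := hf x (occ_eq_one_iff.2 h1)
  rw [occ_eq_one_iff.2 h2] at h3
  omega

lemma notMem_setF'_of_manyPairs {η : Config} (h : η ∈ manyPairs) : η ∉ setF' := by
  simp only [setF', finParticles, Set.mem_iUnion, Set.mem_ofPred_eq, not_exists, not_and]
  intro k _ _ hk
  rw [tsum_eq_top_of_infinite] at hk
  · exact absurd hk.symm (ENNReal.natCast_ne_top k)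
  · refine (infinite_pairs h).mono fun x hx => ?_
    simp only [Set.mem_ofPred_eq, occ_eq_one_iff.2 hx.1, le_refl]

lemma notMem_setE'_of_manyPairs {η : Config} (h : η ∈ manyPairs) : η ∉ setE' := by
  rintro ⟨-, -, hlt⟩
  rw [numPairs, tsum_eq_top_of_infinite] at hlt
  · exact lt_irrefl _ hlt
  · refine (infinite_pairs h).mono fun x hx => ?_
    simp only [Set.mem_ofPred_eq, occ_eq_one_iff.2 hx.1, occ_eq_one_iff.2 hx.2]
    omega

lemma setF'_subset : setF' ⊆ frozenᶜ := by
  intro η hη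
  simp only [setF', Set.mem_iUnion] at hη
  obtain ⟨k, -, h⟩ := hη
  exact h.1

lemma setF''_subset : setF'' ⊆ frozenᶜ := by
  intro η hη
  simp only [setF'', Set.mem_iUnion] at hη
  obtain ⟨k, h⟩ := hη
  exact h.1

lemma setE'_subset : setE' ⊆ frozenᶜ := by
  rintro η ⟨-, hpos, -⟩ hf
  refine hpos.ne' ?_
  rw [numPairs, ENNReal.tsum_eq_zero]
  intro x
  rw [← mul_add]
  by_cases h : occ η x = 1
  · simp [hf x h]
  · have : occ η x = 0 := by
      revert h; unfold occ; cases η x <;> simp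
    simp [this]

lemma full_notMem_frozen : full ∉ frozen := fun h => by
  have := h 0 rfl
  simp [occ, full] at this

lemma full_mem_setF'' : full ∈ setF'' := by
  refine Set.mem_iUnion.2 ⟨0, full_notMem_frozen, ?_⟩
  simp [occ, full]

/-- The configurations with finitely many empty sites. -/
def cofiniteConf : Set Config := Set.range fun (S : Finset ℤ) (y : ℤ) => !decide (y ∈ S)

lemma countable_cofiniteConf : cofiniteConf.Countable := Set.countable_range _

lemma setF''_subset_cofiniteConf : setF'' ⊆ cofiniteConf := by
  intro η hη
  simp only [setF'', Set.mem_iUnion] at hη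
  obtain ⟨k, -, hk⟩ := hη
  have hfin : {x : ℤ | η x = false}.Finite := by
    have hne : ∑' x : ℤ, ((1 - occ η x : ℕ) : ℝ≥0∞) ≠ ∞ := hk ▸ ENNReal.natCast_ne_top k
    by_contra hinf
    refine hne (tsum_eq_top_of_infinite (Set.Infinite.mono (fun x hx => ?_) hinf))
    have hx' : η x = false := hx
    simp [occ, hx']
  refine ⟨hfin.toFinset, ?_⟩
  funext y
  simp

/-- A non-degenerate Bernoulli measure does not charge configurations with infinitely many
particles. -/
lemma bernoulliPi_singleton_cofinite {ρ : unitInterval} (hρ : ρ ≠ 1) {η : Config}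
    (hη : η ∈ cofiniteConf) : bernoulliPi ℤ ρ {η} = 0 := by
  obtain ⟨S, rfl⟩ := hη
  have hinf : ((S : Set ℤ)ᶜ).Infinite := S.finite_toSet.infinite_compl
  have hlt : ENNReal.ofReal ρ < 1 := by
    rw [ENNReal.ofReal_lt_one]
    exact lt_of_le_of_ne ρ.2.2 fun h => hρ (Subtype.ext h)
  have hle : ∀ k : ℕ, bernoulliPi ℤ ρ {fun y => !decide (y ∈ S)} ≤ ENNReal.ofReal ρ ^ k := by
    intro k
    obtain ⟨I, hI, hcard⟩ := hinf.exists_subset_card_eq k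
    rw [← hcard, ← bernoulliPi_ones]
    refine measure_mono ?_
    rintro _ rfl i hi
    have := hI hi
    simpa using this
  exact le_antisymm (ge_of_tendsto' (ENNReal.tendsto_pow_atTop_nhds_zero_iff.2 hlt) hle) zero_le

/-- Exchange-invariant probability measures are stationary. -/
lemma isStationary_of_exch (hc : IsConstraint c) {μ : Measure Config} [IsProbabilityMeasure μ]
    (h : ∀ y, μ.map (exch y) = μ) : IsStationary c μ := by
  refine ⟨inferInstance, fun f ⟨S, hS⟩ => ?_⟩
  obtain ⟨n, hn⟩ := exists_subset_win S
  have hf : DependsOn f (win n : Set ℤ) := hS.mono (by exact_mod_cast hn)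
  obtain ⟨r, -, hr⟩ := hc.exists_range
  have hint : ∀ x, Integrable (fun η => c x η * f η) μ := fun x => by
    obtain ⟨m, hm⟩ := exists_subset_win (Finset.Icc (x - r) (x + r) ∪ S)
    refine integrable_of_dependsOn μ (M := win m) fun η ω hηω => ?_
    rw [hr x fun y hy => hηω y (hm (Finset.mem_union_left _ hy)),
      hS fun y hy => hηω y (hm (Finset.mem_union_right _ hy))]
  have hmp : ∀ x, MeasurePreserving (exch x) μ μ := fun x => ⟨measurable_exch x, h x⟩
  have hint' : ∀ x, Integrable (fun η => c x η * f (exch x η)) μ := fun x => by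
    have := (hmp x).integrable_comp_of_integrable (hint x)
    refine this.congr (ae_of_all _ fun η => ?_)
    simp [hc.exch_eq]
  rw [generator_eq_sum c hf]
  simp_rw [mul_sub]
  have hsub : ∀ x, Integrable (fun η => c x η * f (exch x η) - c x η * f η) μ := fun x =>
    (hint' x).sub (hint x)
  rw [integral_finsetSum _ fun x _ => hsub x]
  refine Finset.sum_eq_zero fun x _ => ?_
  rw [integral_sub (hint' x) (hint x), sub_eq_zero]
  conv_rhs => rw [← h x, integral_map (measurable_exch x).aemeasurable
    (by rw [h x]; exact (hint x).aestronglyMeasurable)]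
  simp only [hc.exch_eq]

/-- Every probability measure on the frozen configurations is stationary. -/
lemma isStationary_of_frozen (hc : IsConstraint c) {μ : Measure Config} [IsProbabilityMeasure μ]
    (h : ∀ᵐ η ∂μ, η ∈ frozen) : IsStationary c μ := by
  refine ⟨inferInstance, fun f _ => integral_eq_zero_of_ae ?_⟩
  filter_upwards [h] with η hη
  refine finsum_eq_zero_of_forall_eq_zero fun x => ?_
  have hfr : ∀ y, η y = true → η (y + 1) = false ∧ η (y + 2) = false := fun y hy => by
    have := hη y (occ_eq_one_iff.2 hy)
    revert this; unfold occ; cases η (y + 1) <;> cases η (y + 2) <;> simp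
  rcases (hc.nonneg x η).eq_or_lt with h0 | h0
  · rw [← h0, zero_mul]
  -- The particle at `x - 1` or `x + 2` that allows the exchange forces both `x` and `x + 1` to be
  -- empty in a frozen configuration.
  · have heq : η x = η (x + 1) := by
      rcases (hc.pos_iff_occupied x η).1 h0 with h1 | h1
      · obtain ⟨h2, h3⟩ := hfr _ h1
        rw [sub_add_cancel] at h2
        rw [show x - 1 + 2 = x + 1 by ring] at h3
        rw [h2, h3]
      · have h2 : η x = false := by
          by_contra h'
          rw [(hfr x (by simpa using h')).2] at h1
          exact absurd h1 (by simp)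
        have h3 : η (x + 1) = false := by
          by_contra h'
          have := (hfr (x + 1) (by simpa using h')).1
          rw [show x + 1 + 1 = x + 2 by ring, h1] at this
          exact absurd this (by simp)
        rw [h2, h3]
    have : exch x η = η := by
      funext y
      by_cases h1 : y = x
      · subst h1; rw [exch_left, heq]
      by_cases h2 : y = x + 1
      · subst h2; rw [exch_right, heq]
      exact exch_of_ne h1 h2 η
    rw [this, sub_self, mul_zero]

lemma exch_full (y : ℤ) : exch y full = full := rfl

/-- Both `manyPairs` and `full` are preserved by exchanges, so the invariance survives the removal
of `full`, which is what excludes density one from the mixture. -/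
lemma IsReversible.map_exch_restrict (hν : IsReversible ν) (y : ℤ) :
    (ν.restrict (manyPairs \ {full})).map (exch y) = ν.restrict (manyPairs \ {full}) := by
  have hm : MeasurableSet (manyPairs \ {full}) :=
    measurableSet_manyPairs.diff (measurableSet_singleton _)
  ext A hA
  rw [Measure.map_apply (measurable_exch y) hA, Measure.restrict_apply hA,
    Measure.restrict_apply (measurable_exch y hA),
    ← hν.measure_exch_preimage y (hA.inter hm) fun η hη => hη.2.1]
  congr 1
  ext η
  have : exch y η = full ↔ η = full := by
    rw [← (exch_involutive y).injective.eq_iff, exch_exch, exch_full]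
  simp [exch_mem_manyPairs, this]

/-- On the configurations with many pairs, a reversible measure is a mixture of non-degenerate
Bernoulli measures, up to the full configuration. -/
lemma IsReversible.exists_mixture (hν : IsReversible ν) [IsFiniteMeasure ν] :
    ∃ lam : Measure unitInterval, lam {0} = 0 ∧ lam {1} = 0 ∧
      ∀ A, MeasurableSet A →
        ν.restrict (manyPairs \ {full}) A = ∫⁻ ρ, bernoulliPi ℤ ρ A ∂lam := by
  obtain ⟨lam, -, hlam⟩ := exists_mixture_of_exchangeable (ν.restrict (manyPairs \ {full}))
    fun I J hIJ => measure_ones_eq_of_exch hν.map_exch_restrict hIJ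
  -- An atom of the mixing measure at a degenerate density would appear as an atom of the mixture at
  -- `ξ`.
  have hatom : ∀ (ρ : unitInterval) (ξ : Config), bernoulliPi ℤ ρ = Measure.dirac ξ →
      ξ ∉ manyPairs \ {full} → lam {ρ} = 0 := by
    intro ρ ξ hρ hξ
    have h0 : ν.restrict (manyPairs \ {full}) {ξ} = 0 := by
      rw [Measure.restrict_apply (measurableSet_singleton ξ),
        Set.singleton_inter_eq_empty.2 hξ, measure_empty]
    rw [hlam _ (measurableSet_singleton ξ)] at h0
    have h1 : ∫⁻ σ in {ρ}, bernoulliPi ℤ σ {ξ} ∂lam ≤ 0 := h0 ▸ setLIntegral_le_lintegral _ _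
    rw [lintegral_singleton, hρ] at h1
    simpa using h1
  refine ⟨lam, hatom 0 _ (bernoulliPi_zero ℤ) fun h => ?_, hatom 1 _ (bernoulliPi_one ℤ) fun h => ?_,
    hlam⟩
  · obtain ⟨x, -, hx, -⟩ := h.1 0
    simp at hx
  · exact h.2 rfl

lemma IsReversible.measure_cofiniteConf (hν : IsReversible ν) [IsFiniteMeasure ν] :
    ν.restrict (manyPairs \ {full}) cofiniteConf = 0 := by
  obtain ⟨lam, -, h1, hlam⟩ := hν.exists_mixture
  rw [← Set.biUnion_of_singleton cofiniteConf, measure_biUnion_null_iff countable_cofiniteConf]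
  intro η hη
  rw [hlam _ (measurableSet_singleton η)]
  have hae : ∀ᵐ ρ ∂lam, ρ ≠ 1 := by
    rw [ae_iff]; simpa using h1
  refine lintegral_eq_zero_of_ae_eq_zero ?_
  filter_upwards [hae] with ρ hρ
  exact bernoulliPi_singleton_cofinite hρ hη

lemma IsReversible.measure_setF''_diff (hν : IsReversible ν) [IsFiniteMeasure ν] :
    ν (setF'' \ {full}) = 0 := by
  have h1 := hν.measure_cofiniteConf
  rw [Measure.restrict_apply countable_cofiniteConf.measurableSet] at h1
  refine measure_mono_null (fun η hη => ?_) (measure_union_null h1 hν.measure_compl_frozen_diff)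
  by_cases h : η ∈ manyPairs
  · exact .inl ⟨setF''_subset_cofiniteConf hη.1, h, hη.2⟩
  · exact .inr ⟨setF''_subset hη.1, h⟩

/-- This replaces `ergodicSet` by an exchange-invariant measurable set. The two differ only by
non-frozen configurations without many pairs and by points of `setF''` other than `full`, both null.
-/
lemma IsReversible.ergodicSet_ae_eq (hν : IsReversible ν) [IsFiniteMeasure ν] :
    ergodicSet =ᵐ[ν] (manyPairs \ {full} : Set Config) := by
  rw [ae_eq_set]
  constructor
  · refine measure_mono_null (fun η hη => ?_) hν.measure_compl_frozen_diff
    simp only [ergodicSet, Set.mem_sdiff, Set.mem_compl_iff, Set.mem_union, not_or] at hη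
    refine ⟨hη.1.1.1.1, fun h => hη.2 ⟨h, fun hfull => ?_⟩⟩
    rw [Set.mem_singleton_iff] at hfull
    exact hη.1.1.2 (hfull ▸ full_mem_setF'')
  · refine measure_mono_null (fun η hη => ?_) hν.measure_setF''_diff
    simp only [ergodicSet, Set.mem_sdiff, Set.mem_compl_iff, Set.mem_union, not_not] at hη
    refine ⟨?_, hη.1.2⟩
    rcases hη.2 with ((h | h) | h) | h
    · exact absurd h (notMem_frozen_of_manyPairs hη.1.1)
    · exact absurd h (notMem_setF'_of_manyPairs hη.1.1)
    · exact h
    · exact absurd h (notMem_setE'_of_manyPairs hη.1.1)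

/-- Non-degenerate Bernoulli measures live on the ergodic set. -/
lemma bernoulliPi_ergodicSet {ρ : unitInterval} (h0 : ρ ≠ 0) (h1 : ρ ≠ 1) :
    bernoulliPi ℤ ρ ergodicSet = 1 := by
  have hG : bernoulliPi ℤ ρ manyPairs = 1 := by
    refine le_antisymm prob_le_one ?_
    rw [← bernoulliPi_infPairs h0, ← bernoulliPi_map_restrictHalfLine ρ 0,
      Measure.map_apply (measurable_restrictHalfLine 0) measurableSet_infPairs]
    exact measure_mono fun η hη => restrictHalfLine_mem_infPairs hη
  have hC : bernoulliPi ℤ ρ cofiniteConf = 0 := by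
    rw [← Set.biUnion_of_singleton cofiniteConf, measure_biUnion_null_iff countable_cofiniteConf]
    exact fun η hη => bernoulliPi_singleton_cofinite h1 hη
  refine le_antisymm prob_le_one ?_
  rw [← hG, ← measure_sdiff_null (s := manyPairs) hC]
  refine measure_mono fun η hη => ?_
  simp only [ergodicSet, Set.mem_compl_iff, Set.mem_union, not_or]
  exact ⟨⟨⟨notMem_frozen_of_manyPairs hη.1, notMem_setF'_of_manyPairs hη.1⟩,
    fun h => hη.2 (setF''_subset_cofiniteConf h)⟩, notMem_setE'_of_manyPairs hη.1⟩

lemma exists_isStationary_frozen (hc : IsConstraint c) (ν : Measure Config) [IsFiniteMeasure ν] :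
    ∃ μ : Measure Config, IsStationary c μ ∧ μ frozen = 1 ∧
      ν.restrict frozen = ν frozen • μ := by
  by_cases h : ν frozen = 0
  -- With weight zero any stationary measure on `frozen` serves; the Dirac mass at the empty
  -- configuration is one.
  · have hmem : (fun _ => false : Config) ∈ frozen := fun x hx => by simp [occ] at hx
    refine ⟨Measure.dirac fun _ => false, isStationary_of_frozen hc ?_, ?_, ?_⟩
    · exact (ae_dirac_iff (p := (· ∈ frozen)) measurableSet_frozen).2 hmem
    · exact Measure.dirac_apply_of_mem hmem
    · rw [h, zero_smul, Measure.restrict_eq_zero, h]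
  · have hp : IsProbabilityMeasure ((ν frozen)⁻¹ • ν.restrict frozen) := ⟨by
      simp [ENNReal.inv_mul_cancel h (measure_ne_top _ _)]⟩
    refine ⟨(ν frozen)⁻¹ • ν.restrict frozen, isStationary_of_frozen hc ?_, ?_, ?_⟩
    · exact Measure.ae_smul_measure (ae_restrict_mem measurableSet_frozen) _
    · simp [ENNReal.inv_mul_cancel h (measure_ne_top _ _)]
    · rw [smul_smul, ENNReal.mul_inv_cancel h (measure_ne_top _ _), one_smul]

lemma IsReversible.exists_isStationary_ergodicSet (hc : IsConstraint c) (hν : IsReversible ν)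
    [IsFiniteMeasure ν] :
    ∃ μ : Measure Config, IsStationary c μ ∧ μ ergodicSet = 1 ∧
      ν.restrict ergodicSet = ν ergodicSet • μ ∧
      (0 < ν ergodicSet → ∃ lam : Measure unitInterval, IsProbabilityMeasure lam ∧
        lam (Set.Ioo 0 1) = 1 ∧ ∀ A : Set Config, MeasurableSet A →
          μ A = ∫⁻ ρ, prodBernoulli ρ A ∂lam) := by
  by_cases h : ν ergodicSet = 0
  -- With weight zero any non-degenerate Bernoulli measure serves.
  · let ρ : unitInterval := ⟨1 / 2, by norm_num, by norm_num⟩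
    have h0 : ρ ≠ 0 := fun h => by simpa [ρ] using congrArg Subtype.val h
    have h1 : ρ ≠ 1 := fun h => by
      have := congrArg Subtype.val h
      norm_num [ρ] at this
    refine ⟨bernoulliPi ℤ ρ, isStationary_of_exch hc (bernoulliPi_map_exch ρ),
      bernoulliPi_ergodicSet h0 h1, ?_, fun h' => absurd h h'.ne'⟩
    rw [h, zero_smul, Measure.restrict_eq_zero, h]
  · have hres := Measure.restrict_congr_set hν.ergodicSet_ae_eq
    have hinv : (ν ergodicSet)⁻¹ * ν ergodicSet = 1 :=
      ENNReal.inv_mul_cancel h (measure_ne_top _ _)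
    have hp : IsProbabilityMeasure ((ν ergodicSet)⁻¹ • ν.restrict ergodicSet) := ⟨by simp [hinv]⟩
    refine ⟨(ν ergodicSet)⁻¹ • ν.restrict ergodicSet, isStationary_of_exch hc fun y => ?_, ?_, ?_,
      fun _ => ?_⟩
    · rw [Measure.map_smul, hres, hν.map_exch_restrict]
    · simp [hinv]
    · rw [smul_smul, ENNReal.mul_inv_cancel h (measure_ne_top _ _), one_smul]
    · obtain ⟨lam, h0, h1, hlam⟩ := hν.exists_mixture
      have huniv : lam Set.univ = ν ergodicSet := by
        have := hlam Set.univ MeasurableSet.univ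
        rw [← hres] at this
        simpa using this.symm
      have hIoo : (Set.Ioo 0 1 : Set unitInterval) = ({0} ∪ {1})ᶜ := by
        ext ρ
        simp only [Set.mem_Ioo, Set.mem_compl_iff, Set.mem_union, Set.mem_singleton_iff, not_or]
        exact ⟨fun h => ⟨h.1.ne', h.2.ne⟩, fun h => ⟨unitInterval.pos_iff_ne_zero.2 h.1,
          unitInterval.lt_one_iff_ne_one.2 h.2⟩⟩
      have hlp : IsProbabilityMeasure ((ν ergodicSet)⁻¹ • lam) := ⟨by simp [huniv, hinv]⟩
      refine ⟨(ν ergodicSet)⁻¹ • lam, hlp, ?_, fun A hA => ?_⟩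
      · rw [hIoo, prob_compl_eq_one_iff
          ((measurableSet_singleton _).union (measurableSet_singleton _))]
        rw [Measure.smul_apply, measure_union_null h0 h1, smul_zero]
      · rw [lintegral_smul_measure, Measure.smul_apply, hres, hlam A hA]
        rfl

/-- Up to a null set, `frozen`, `{full}` and `manyPairs \ {full}` partition the space, since almost
every non-frozen configuration has many pairs. -/
lemma IsReversible.eq_sum_restrict (hν : IsReversible ν) [IsFiniteMeasure ν] :
    ν = ν.restrict frozen + ν {full} • Measure.dirac full + ν.restrict ergodicSet := by
  rw [← Measure.restrict_singleton, Measure.restrict_congr_set hν.ergodicSet_ae_eq,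
    ← Measure.restrict_union _ (measurableSet_singleton _), ← Measure.restrict_union]
  · refine (Measure.restrict_eq_self_of_ae_mem ?_).symm
    rw [ae_iff]
    refine measure_mono_null (fun η hη => ?_) hν.measure_compl_frozen_diff
    simp only [Set.mem_ofPred_eq, Set.mem_union, Set.mem_sdiff, not_or] at hη
    exact ⟨hη.1.1, fun h => hη.2 ⟨h, hη.1.2⟩⟩
  · rw [Set.disjoint_left]
    rintro η (h | h) hG
    · exact notMem_frozen_of_manyPairs hG.1 h
    · exact hG.2 h
  · exact measurableSet_manyPairs.diff (measurableSet_singleton _)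
  · rw [Set.disjoint_singleton_right]
    exact full_notMem_frozen

end Decomposition

end PorousMedium

theorem theorem1 (c : ℤ → PorousMedium.Config → ℝ) (hc : PorousMedium.IsConstraint c)
    (ν : Measure PorousMedium.Config) (hν : PorousMedium.IsStationary c ν) :
    (∃ νF νE : Measure PorousMedium.Config,
      PorousMedium.IsStationary c νF ∧ νF PorousMedium.frozen = 1 ∧
      PorousMedium.IsStationary c νE ∧ νE PorousMedium.ergodicSet = 1 ∧
      ν = ν PorousMedium.frozen • νF
        + ν {PorousMedium.full} • Measure.dirac PorousMedium.full
        + ν PorousMedium.ergodicSet • νE ∧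
      (0 < ν PorousMedium.ergodicSet →
        ∃ lam : Measure unitInterval, IsProbabilityMeasure lam ∧ lam (Set.Ioo 0 1) = 1 ∧
          ∀ A : Set PorousMedium.Config, MeasurableSet A →
            νE A = ∫⁻ ρ, PorousMedium.prodBernoulli ρ A ∂lam)) ∧
    ν PorousMedium.setF' = 0 ∧
    ν (PorousMedium.setF'' \ {PorousMedium.full}) = 0 ∧
    ν PorousMedium.setE' = 0 := by
  have := hν.1
  have hrev := hν.isReversible hc
  obtain ⟨νF, hF, hF1, hFeq⟩ := PorousMedium.exists_isStationary_frozen hc ν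
  obtain ⟨νE, hE, hE1, hEeq, hmix⟩ := hrev.exists_isStationary_ergodicSet hc
  refine ⟨⟨νF, νE, hF, hF1, hE, hE1, ?_, hmix⟩, ?_, hrev.measure_setF''_diff, ?_⟩
  · rw [← hFeq, ← hEeq]
    exact hrev.eq_sum_restrict
  · refine measure_mono_null (fun η h => ?_) hrev.measure_compl_frozen_diff
    exact ⟨PorousMedium.setF'_subset h,
      fun h' => PorousMedium.notMem_setF'_of_manyPairs h' h⟩
  · refine measure_mono_null (fun η h => ?_) hrev.measure_compl_frozen_diff
    exact ⟨PorousMedium.setE'_subset h,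
      fun h' => PorousMedium.notMem_setE'_of_manyPairs h' h⟩
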